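/- \textbf{Setting.} Let $\Pi$ be the upper half-plane and let $SL(2,\mathbb R)^{\sim}$ be the universal covering group of $SL(2,\mathbb R)$, realized as the group of pairs $\tilde g=(g,\varphi)$ with $g=\begin{pmatrix}a&b\\c&d\end{pmatrix}\in SL(2,\mathbb R)$ and $\varphi\colon\Pi\to\mathbb C$ a continuous function with $e^{\varphi(z)}=cz+d$, where $(g_1,\varphi_1)(g_2,\varphi_2)=(g_1g_2,\ z\mapsto\varphi_1(g_2z)+\varphi_2(z))$. For $\lambda\in\mathbb R$ it acts on functions on $\Pi$ by $(\pi_\lambda(\tilde g)f)(z)=e^{-\lambda\varphi(z)}f\!\left(\frac{az+b}{cz+d}\right)$, where $\tilde g^{-1}=\left(\begin{pmatrix}a&b\\c&d\end{pmatrix},\varphi\right)$. For $\lambda>1$ put $L^2(\mathbb R_+)_\lambda=L^2(\mathbb R_+,x^{1-\lambda}dx)$. The Fourier--Laplace transform $\mathcal F F(z)=\int_0^\infty F(x)e^{izx}\,dx$ ($z\in\Pi$) is injective on $L^2(\mathbb R_+)_\lambda$, and there is a unique unitary representation (homomorphism into the unitary group) $\rho_\lambda$ of $SL(2,\mathbb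 R)^{\sim}$ on $L^2(\mathbb R_+)_\lambda$ (the $L^2$-model) with $\mathcal F(\rho_\lambda(\tilde g)F)=\pi_\lambda(\tilde g)(\mathcal F F)$ for all $\tilde g$ and $F$. The completed tensor product $L^2(\mathbb R_+)_{\lambda'}\widehat\otimes L^2(\mathbb R_+)_{\lambda''}$ is identified with $L^2(\mathbb R_+\times\mathbb R_+,x^{1-\lambda'}y^{1-\lambda''}dx\,dy)$ through $(u\otimes v)(x,y)=u(x)v(y)$. The tensor product $\tau$ of two unitary representations $\rho'$ and $\rho''$ of $SL(2,\mathbb R)^{\sim}$ on the two factors is the unique unitary representation on this space with $\tau(\tilde g)(u\otimes v)=\rho'(\tilde g)u\otimes\rho''(\tilde g)v$. Finally, for $\ell\in\mathbb N=\{0,1,2,\dots\}$, $$P_\ell^{\alpha,\beta}(t)=\sum_{j=0}^{\ell}\frac{(\alpha+\beta+\ell+1)_j(\alpha+j+1)_{\ell-j}}{(\ell-j)!\,j!}\left(\frac{t-1}{2}\right)^j$$ is the Jacobi polynomial, where $(s)_j=s(s+1)\cdots(s+j-1)$. \textbf{Theorem.} Let $\lambda',\lambda'',\lambda'''>1$ be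 real numbers such that $\ell:=\frac12(\lambda'''-\lambda'-\lambda'')\in\mathbb N$. Then the representations $\rho_{\lambda'}$, $\rho_{\lambda''}$, $\rho_{\lambda'''}$ and the tensor product representation $\tau$ of $\rho_{\lambda'}$ and $\rho_{\lambda''}$ described above exist and are unique, and the formula $$(\Phi_{\lambda',\lambda''}^{\lambda'''}h)(x,y)=x^{\lambda'-1}y^{\lambda''-1}(x+y)^{-\lambda'-\lambda''-\ell+1}P_\ell^{\lambda'-1,\lambda''-1}\!\left(\frac{y-x}{x+y}\right)h(x+y)\qquad(x,y>0)$$ defines a continuous linear operator $$\Phi_{\lambda',\lambda''}^{\lambda'''}\colon L^2(\mathbb R_+)_{\lambda'''}\longrightarrow L^2(\mathbb R_+)_{\lambda'}\widehat\otimes L^2(\mathbb R_+)_{\lambda''}$$ which is $SL(2,\mathbb R)^{\sim}$-equivariant: $\Phi_{\lambda',\lambda''}^{\lambda'''}\circ\rho_{\lambda'''}(\tilde g)=\tau(\tilde g)\circ\Phi_{\lambda',\lambda''}^{\lambda'''}$ for all $\tilde g\in SL(2,\mathbb R)^{\sim}$. -/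

import Mathlib

open MeasureTheory
open scoped UpperHalfPlane

noncomputable section

namespace Holographic

/-- The automorphy factor `c z + d` of `g = (a b; c d)` in `SL(2, ℝ)` at a point `z` of the upper
half-plane. -/
def autoFactor (g : Matrix.SpecialLinearGroup (Fin 2) ℝ) (z : ℍ) : ℂ :=
  ((g 1 0 : ℝ) : ℂ) * (z : ℂ) + ((g 1 1 : ℝ) : ℂ)

theorem autoFactor_eq_denom (g : Matrix.SpecialLinearGroup (Fin 2) ℝ) (z : ℍ) :
    autoFactor g z = UpperHalfPlane.denom (Matrix.SpecialLinearGroup.mapGL ℝ g) z := by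
  simp [autoFactor, UpperHalfPlane.denom]

theorem autoFactor_one (z : ℍ) : autoFactor 1 z = 1 := by
  simp [autoFactor]

theorem autoFactor_mul (g h : Matrix.SpecialLinearGroup (Fin 2) ℝ) (z : ℍ) :
    autoFactor (g * h) z = autoFactor g (h • z) * autoFactor h z := by
  have hz : (h 1 0 : ℂ) * z + h 1 1 ≠ 0 := by
    have := UpperHalfPlane.denom_ne_zero (Matrix.SpecialLinearGroup.mapGL ℝ h) z
    rwa [← autoFactor_eq_denom] at this
  simp only [autoFactor, UpperHalfPlane.coe_specialLinearGroup_apply,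
    Matrix.SpecialLinearGroup.coe_mul, Matrix.mul_apply, Fin.sum_univ_two]
  simp only [Algebra.algebraMap_self, RingHom.id_apply]
  push_cast
  field_simp
  ring

/-- The universal covering group of `SL(2, ℝ)`, in its standard model: the pairs of an element `g`
of `SL(2, ℝ)` and a continuous (hence holomorphic) branch `logFactor` on the upper half-plane of
`log (c z + d)`.  The covering map is `toSL`; each of its fibres is a torsor under `2 π i ℤ`, and
along the loop `SO(2)` the logarithm picks up `2 π i`, so that this connected covering is the
universal one. -/
@[ext]
structure SL2Cover where
  toSL : Matrix.SpecialLinearGroup (Fin 2) ℝ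
  logFactor : ℍ → ℂ
  continuous_logFactor : Continuous logFactor
  exp_logFactor : ∀ z, Complex.exp (logFactor z) = autoFactor toSL z

namespace SL2Cover

theorem continuous_smul_sl (g : Matrix.SpecialLinearGroup (Fin 2) ℝ) :
    Continuous fun z : ℍ => g • z :=
  continuous_const_smul (Matrix.SpecialLinearGroup.mapGL ℝ g)

instance : Mul SL2Cover where
  mul g h :=
    { toSL := g.toSL * h.toSL
      logFactor := fun z => g.logFactor (h.toSL • z) + h.logFactor z
      continuous_logFactor :=
        (g.continuous_logFactor.comp (continuous_smul_sl _)).add h.continuous_logFactor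
      exp_logFactor := fun z => by
        rw [Complex.exp_add, g.exp_logFactor, h.exp_logFactor, autoFactor_mul] }

instance : One SL2Cover where
  one :=
    { toSL := 1
      logFactor := fun _ => 0
      continuous_logFactor := continuous_const
      exp_logFactor := fun z => by rw [Complex.exp_zero, autoFactor_one] }

instance : Inv SL2Cover where
  inv g :=
    { toSL := g.toSL⁻¹
      logFactor := fun z => -g.logFactor (g.toSL⁻¹ • z)
      continuous_logFactor := (g.continuous_logFactor.comp (continuous_smul_sl _)).neg
      exp_logFactor := fun z => by
        have h := autoFactor_mul g.toSL g.toSL⁻¹ z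
        rw [mul_inv_cancel, autoFactor_one] at h
        rw [Complex.exp_neg, g.exp_logFactor]
        exact inv_eq_of_mul_eq_one_right h.symm }

@[simp] theorem mul_toSL (g h : SL2Cover) : (g * h).toSL = g.toSL * h.toSL := rfl
@[simp] theorem mul_logFactor (g h : SL2Cover) (z : ℍ) :
    (g * h).logFactor z = g.logFactor (h.toSL • z) + h.logFactor z := rfl
@[simp] theorem one_toSL : (1 : SL2Cover).toSL = 1 := rfl
@[simp] theorem one_logFactor (z : ℍ) : (1 : SL2Cover).logFactor z = 0 := rfl
@[simp] theorem inv_toSL (g : SL2Cover) : (g⁻¹).toSL = g.toSL⁻¹ := rfl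
@[simp] theorem inv_logFactor (g : SL2Cover) (z : ℍ) :
    (g⁻¹).logFactor z = -g.logFactor (g.toSL⁻¹ • z) := rfl

instance : Group SL2Cover :=
  Group.ofLeftAxioms
    (fun a b c => by
      refine SL2Cover.ext (mul_assoc _ _ _) (funext fun z => ?_)
      simp [mul_smul, add_assoc])
    (fun a => by
      refine SL2Cover.ext (one_mul _) (funext fun z => ?_)
      simp)
    (fun a => by
      refine SL2Cover.ext (inv_mul_cancel _) (funext fun z => ?_)
      simp)

end SL2Cover

/-- The action `π_lam` of the universal covering group of `SL(2, ℝ)` on functions on the upper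
half-plane: `(π_lam(g) f)(z) = (c z + d) ^ (-lam) * f ((a z + b) / (c z + d))` for
`g⁻¹ = (a b; c d)`, the power being taken with the branch of the logarithm carried by `g⁻¹`. -/
def multiplierAction (lam : ℝ) (g : SL2Cover) (f : ℍ → ℂ) (z : ℍ) : ℂ :=
  Complex.exp (-(lam : ℂ) * (g⁻¹).logFactor z) * f ((g⁻¹).toSL • z)

/-- The measure `x ^ (1 - lam) dx` on the positive half-line, as a measure on `ℝ`. -/
def weightMeasure (lam : ℝ) : Measure ℝ :=
  (volume.restrict (Set.Ioi (0 : ℝ))).withDensity fun x => ENNReal.ofReal (x ^ (1 - lam))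

instance (lam : ℝ) : SigmaFinite (weightMeasure lam) :=
  SigmaFinite.withDensity_of_ne_top' fun _ => ENNReal.ofReal_ne_top

/-- The Hilbert space `L²(ℝ₊, x ^ (1 - lam) dx)`. -/
abbrev L2Half (lam : ℝ) : Type := Lp ℂ 2 (weightMeasure lam)

/-- The Hilbert space `L²(ℝ₊ × ℝ₊, x ^ (1 - lam₁) y ^ (1 - lam₂) dx dy)`, which is the completed
tensor product of `L²(ℝ₊, x ^ (1 - lam₁) dx)` and `L²(ℝ₊, y ^ (1 - lam₂) dy)`. -/
abbrev L2Quadrant (lam₁ lam₂ : ℝ) : Type :=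
  Lp ℂ 2 ((weightMeasure lam₁).prod (weightMeasure lam₂))

theorem memLp_tensor {lam₁ lam₂ : ℝ} (u : L2Half lam₁) (v : L2Half lam₂) :
    MemLp (fun p : ℝ × ℝ => u p.1 * v p.2) 2
      ((weightMeasure lam₁).prod (weightMeasure lam₂)) := by
  have hu := Lp.memLp u
  have hv := Lp.memLp v
  have hm : AEStronglyMeasurable (fun p : ℝ × ℝ => u p.1 * v p.2)
      ((weightMeasure lam₁).prod (weightMeasure lam₂)) :=
    hu.1.comp_fst.mul hv.1.comp_snd
  rw [memLp_two_iff_integrable_sq_norm hm]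
  have := ((memLp_two_iff_integrable_sq_norm hu.1).1 hu).mul_prod
    ((memLp_two_iff_integrable_sq_norm hv.1).1 hv)
  simpa [mul_pow] using this

/-- The elementary tensor `u ⊗ v`, the function `(x, y) ↦ u x * v y`. -/
def tensor {lam₁ lam₂ : ℝ} (u : L2Half lam₁) (v : L2Half lam₂) : L2Quadrant lam₁ lam₂ :=
  (memLp_tensor u v).toLp _

/-- The Fourier--Laplace transform `z ↦ ∫₀^∞ F(x) exp(i z x) dx` on the upper half-plane. -/
def fourierLaplace (F : ℝ → ℂ) (z : ℍ) : ℂ :=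
  ∫ x in Set.Ioi (0 : ℝ), F x * Complex.exp (Complex.I * (z : ℂ) * (x : ℂ))

/-- `ρ` is the `L²`-model of the holomorphic discrete series representation `π_lam`: the unitary
representation on `L²(ℝ₊, x ^ (1 - lam) dx)` that the Fourier--Laplace transform carries to
`π_lam`. -/
def IsL2Model (lam : ℝ) (ρ : SL2Cover →* (L2Half lam ≃ₗᵢ[ℂ] L2Half lam)) : Prop :=
  ∀ (g : SL2Cover) (F : L2Half lam) (z : ℍ),
    fourierLaplace (ρ g F) z = multiplierAction lam g (fourierLaplace F) z

/-- `τ` is the tensor product of the representations `ρ₁` and `ρ₂` (on the completed tensor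
product, the group acting diagonally). -/
def IsTensorProductRep {lam₁ lam₂ : ℝ} (ρ₁ : SL2Cover →* (L2Half lam₁ ≃ₗᵢ[ℂ] L2Half lam₁))
    (ρ₂ : SL2Cover →* (L2Half lam₂ ≃ₗᵢ[ℂ] L2Half lam₂))
    (τ : SL2Cover →* (L2Quadrant lam₁ lam₂ ≃ₗᵢ[ℂ] L2Quadrant lam₁ lam₂)) : Prop :=
  ∀ (g : SL2Cover) (u : L2Half lam₁) (v : L2Half lam₂),
    τ g (tensor u v) = tensor (ρ₁ g u) (ρ₂ g v)

/-- The Jacobi polynomial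
`P_ℓ^{α,β}(t) = ∑_j (α+β+ℓ+1)_j (α+j+1)_{ℓ-j} / ((ℓ-j)! j!) * ((t-1)/2)^j`. -/
def jacobiP (ℓ : ℕ) (α β t : ℝ) : ℝ :=
  ∑ j ∈ Finset.range (ℓ + 1),
    (ascPochhammer ℝ j).eval (α + β + ℓ + 1) * (ascPochhammer ℝ (ℓ - j)).eval (α + j + 1) /
      (((ℓ - j).factorial : ℝ) * (j.factorial : ℝ)) * ((t - 1) / 2) ^ j

/-- The function `(x, y) ↦ x^{lam₁-1} y^{lam₂-1} (x+y)^{-lam₁-lam₂-ℓ+1}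
P_ℓ^{lam₁-1,lam₂-1}((y-x)/(x+y)) h(x+y)`, to be considered for `x, y > 0`. -/
def holographicFun (lam₁ lam₂ : ℝ) (ℓ : ℕ) (h : ℝ → ℂ) (p : ℝ × ℝ) : ℂ :=
  ((p.1 ^ (lam₁ - 1) * p.2 ^ (lam₂ - 1) * (p.1 + p.2) ^ (-lam₁ - lam₂ - ℓ + 1) *
      jacobiP ℓ (lam₁ - 1) (lam₂ - 1) ((p.2 - p.1) / (p.1 + p.2)) : ℝ) : ℂ) * h (p.1 + p.2)

end Holographic

end

open Holographic

/-! Everything is tested on reproducing kernels. Evaluation at `z` of the Fourier–Laplace transform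
is the inner product with `k_z(x) = x^(λ-1) exp(-i z̄ x)`, and the `k_z` are total because the
Fourier transform is injective on integrable functions. Write `p(z,w) = -i(z - w̄)`, of positive
real part, and `φ` for the logarithm carried by `g`. The Gamma integral gives `⟪k_z, k_w⟫ = Γ(λ)
p(z,w)^(-λ)`.

A representation is the `L²`-model exactly when it sends `k_z` to `exp(-λ conj φ(z)) k_{gz}`.
Uniqueness is then totality. Existence is invariance of the Gram matrix, which follows from `log
p(gz,gw) = log p(z,w) - φ(z) - conj φ(w)` (`log_polar_smul`). The tensor product is obtained in the
same way from the pure tensors.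

Boundedness of `Φ` is a pointwise bound on its weight, followed by integration over the segments `x
+ y = s`. For equivariance, the homogeneous form of the Jacobi polynomial (`jacobiP_homogeneous`)
turns `Φ k_w` into a finite sum of products in `x` and `y`. Gamma integrals and the binomial theorem
then show that `⟪k_{z₁} ⊗ k_{z₂}, Φ k_w⟫` is a constant times `p₁^(-λ') p₂^(-λ'') (p₂⁻¹ - p₁⁻¹)^ℓ`
with `p_j = p(z_j, w)`. This kernel is covariant of weights `λ'`, `λ''`, `λ''' = λ' + λ'' + 2ℓ`
(`holographicKernel_smul`), and totality of the kernels and of their tensors finishes the proof. -/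

namespace Holographic
open scoped InnerProductSpace

/-! ### Total families and unitary representations prescribed on them -/

section Hilbert

variable {H : Type*} [NormedAddCommGroup H] [InnerProductSpace ℂ H] {ι : Type*}

/-- A family of vectors whose orthogonal complement vanishes. -/
def IsTotal (e : ι → H) : Prop :=
  ∀ x : H, (∀ i, ⟪e i, x⟫_ℂ = 0) → x = 0

theorem IsTotal.ext {e : ι → H} (he : IsTotal e) {x y : H} (h : ∀ i, ⟪e i, x⟫_ℂ = ⟪e i, y⟫_ℂ) :
    x = y :=
  sub_eq_zero.1 (he _ fun i => by rw [inner_sub_right, h, sub_self])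

theorem IsTotal.span_topologicalClosure [CompleteSpace H] {e : ι → H} (he : IsTotal e) :
    (Submodule.span ℂ (Set.range e)).topologicalClosure = ⊤ := by
  rw [Submodule.topologicalClosure_eq_top_iff, Submodule.eq_bot_iff]
  exact fun x hx => he x fun i => hx _ (Submodule.subset_span ⟨i, rfl⟩)

theorem IsTotal.dense_span [CompleteSpace H] {e : ι → H} (he : IsTotal e) :
    Dense (Submodule.span ℂ (Set.range e) : Set H) :=
  Submodule.dense_iff_topologicalClosure_eq_top.2 he.span_topologicalClosure

theorem IsTotal.eq_of_forall_apply_eq [CompleteSpace H] {K : Type*} [NormedAddCommGroup K]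
    [NormedSpace ℂ K] {e : ι → H} (he : IsTotal e) {S T : H →L[ℂ] K}
    (h : ∀ i, S (e i) = T (e i)) : S = T :=
  ContinuousLinearMap.ext_on he.dense_span (by rintro _ ⟨i, rfl⟩; exact h i)

theorem IsTotal.eq_of_forall_apply_eq' [CompleteSpace H] {e : ι → H} (he : IsTotal e)
    {S T : H ≃ₗᵢ[ℂ] H} (h : ∀ i, S (e i) = T (e i)) : S = T := by
  have := he.eq_of_forall_apply_eq (S := (S.toContinuousLinearEquiv : H →L[ℂ] H))
    (T := (T.toContinuousLinearEquiv : H →L[ℂ] H)) h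
  ext x
  exact congrArg (fun A : H →L[ℂ] H => A x) this

theorem norm_linearCombination_eq_of_inner_eq {e f : ι → H}
    (h : ∀ i j, ⟪f i, f j⟫_ℂ = ⟪e i, e j⟫_ℂ) (a : ι →₀ ℂ) :
    ‖Finsupp.linearCombination ℂ f a‖ = ‖Finsupp.linearCombination ℂ e a‖ := by
  have key : ⟪Finsupp.linearCombination ℂ f a, Finsupp.linearCombination ℂ f a⟫_ℂ =
      ⟪Finsupp.linearCombination ℂ e a, Finsupp.linearCombination ℂ e a⟫_ℂ := by
    simp only [Finsupp.linearCombination_apply, Finsupp.sum_inner, Finsupp.inner_sum,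
      inner_smul_left, inner_smul_right, h]
  rw [@norm_eq_sqrt_re_inner ℂ, @norm_eq_sqrt_re_inner ℂ, key]

/-- Two families with the same Gram matrix, the first of them total, are related by a linear
isometry. -/
theorem IsTotal.exists_isometry [CompleteSpace H] {e f : ι → H} (he : IsTotal e)
    (h : ∀ i j, ⟪f i, f j⟫_ℂ = ⟪e i, e j⟫_ℂ) :
    ∃ U : H →ₗᵢ[ℂ] H, ∀ i, U (e i) = f i := by
  have hd : DenseRange (Finsupp.linearCombination ℂ e) := by
    have := he.dense_span
    rwa [← Finsupp.range_linearCombination] at this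
  have hn := norm_linearCombination_eq_of_inner_eq h
  -- Equal Gram matrices make `∑ aᵢ eᵢ ↦ ∑ aᵢ fᵢ` well defined and isometric on a dense subspace, so
  -- it extends by continuity.
  set A := (Finsupp.linearCombination ℂ f).extendOfNorm (Finsupp.linearCombination ℂ e)
  have hA : ∀ a, A (Finsupp.linearCombination ℂ e a) = Finsupp.linearCombination ℂ f a :=
    LinearMap.extendOfNorm_eq hd ⟨1, fun a => by rw [hn, one_mul]⟩
  refine ⟨⟨A.toLinearMap, fun x => ?_⟩, fun i => ?_⟩
  · refine hd.induction_on (p := fun x => ‖A x‖ = ‖x‖) x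
      (isClosed_eq A.continuous.norm continuous_norm) fun a => ?_
    rw [hA, hn]
  · simpa using hA (Finsupp.single i 1)

/-- A family of systems with the Gram matrix of a total system `e` and compatible with the group
law is the orbit of `e` under a unitary representation. -/
theorem IsTotal.exists_unitaryRep [CompleteSpace H] {G : Type*} [Group G] {e : ι → H}
    (he : IsTotal e) (T : G → ι → H) (hT : ∀ g i j, ⟪T g i, T g j⟫_ℂ = ⟪e i, e j⟫_ℂ)
    (h_one : T 1 = e)
    (h_mul : ∀ g h i, ∃ (c : ℂ) (j : ι), T h i = c • e j ∧ T (g * h) i = c • T g j) :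
    ∃ ρ : G →* (H ≃ₗᵢ[ℂ] H), ∀ g i, ρ g (e i) = T g i := by
  choose U hU using fun g => he.exists_isometry (hT g)
  have hmul : ∀ g h x, U (g * h) x = U g (U h x) := fun g h x => by
    have := he.eq_of_forall_apply_eq (S := (U (g * h)).toContinuousLinearMap)
      (T := (U g).toContinuousLinearMap.comp (U h).toContinuousLinearMap) fun i => by
        obtain ⟨c, j, h₁, h₂⟩ := h_mul g h i
        simp [hU, h₁, h₂]
    exact congrArg (fun A : H →L[ℂ] H => A x) this
  have hone : ∀ x, U 1 x = x := fun x => by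
    have := he.eq_of_forall_apply_eq (S := (U 1).toContinuousLinearMap)
      (T := ContinuousLinearMap.id ℂ H) fun i => by simp [hU, h_one]
    exact congrArg (fun A : H →L[ℂ] H => A x) this
  have hinv : ∀ g x, U g (U g⁻¹ x) = x := fun g x => by rw [← hmul, mul_inv_cancel, hone]
  have hinv' : ∀ g x, U g⁻¹ (U g x) = x := fun g x => by rw [← hmul, inv_mul_cancel, hone]
  -- Surjectivity is not assumed: the isometry of `g⁻¹` is a two-sided inverse.
  refine ⟨MonoidHom.mk' (fun g => ⟨LinearEquiv.ofLinearMap (U g).toLinearMap (U g⁻¹).toLinearMap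
    (LinearMap.ext (hinv g)) (LinearMap.ext (hinv' g)), (U g).norm_map⟩) fun g h => ?_, hU⟩
  ext x
  exact hmul g h x

theorem unitaryRep_inv_apply_apply {G : Type*} [Group G] (ρ : G →* (H ≃ₗᵢ[ℂ] H)) (g : G) (x : H) :
    ρ g⁻¹ (ρ g x) = x := by
  have := congrArg (fun A : H ≃ₗᵢ[ℂ] H => A x) (map_mul ρ g⁻¹ g)
  rw [inv_mul_cancel, map_one] at this
  exact this.symm

theorem unitaryRep_apply_inv_apply {G : Type*} [Group G] (ρ : G →* (H ≃ₗᵢ[ℂ] H)) (g : G) (x : H) :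
    ρ g (ρ g⁻¹ x) = x := by
  have := unitaryRep_inv_apply_apply ρ g⁻¹ x
  rwa [inv_inv] at this

end Hilbert

/-! ### The weighted measure and the Gamma integral -/

theorem integral_weightMeasure (lam : ℝ) (f : ℝ → ℂ) :
    ∫ x, f x ∂(weightMeasure lam) = ∫ x in Set.Ioi (0 : ℝ), ((x ^ (1 - lam) : ℝ) : ℂ) * f x := by
  rw [weightMeasure, integral_withDensity_eq_integral_toReal_smul (by fun_prop) (by simp)]
  refine setIntegral_congr_fun measurableSet_Ioi fun x hx => ?_
  have hx : 0 ≤ x ^ (1 - lam) := Real.rpow_nonneg (le_of_lt hx) _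
  simp [ENNReal.toReal_ofReal hx]

theorem integrable_weightMeasure_iff {E : Type*} [NormedAddCommGroup E] [NormedSpace ℝ E]
    (lam : ℝ) (f : ℝ → E) : Integrable f (weightMeasure lam) ↔
      IntegrableOn (fun x => x ^ (1 - lam) • f x) (Set.Ioi 0) := by
  rw [weightMeasure, integrable_withDensity_iff_integrable_smul' (by fun_prop) (by simp)]
  refine integrableOn_congr_fun (fun x hx => ?_) measurableSet_Ioi
  have hx : 0 ≤ x ^ (1 - lam) := Real.rpow_nonneg (le_of_lt hx) _
  simp [ENNReal.toReal_ofReal hx]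

theorem weightMeasure_absolutelyContinuous (lam : ℝ) :
    weightMeasure lam ≪ volume.restrict (Set.Ioi 0) :=
  withDensity_absolutelyContinuous _ _

theorem restrict_absolutelyContinuous_weightMeasure (lam : ℝ) :
    volume.restrict (Set.Ioi 0) ≪ weightMeasure lam := by
  refine withDensity_absolutelyContinuous' (by fun_prop) ?_
  filter_upwards [ae_restrict_mem measurableSet_Ioi] with x hx
  simpa using Real.rpow_pos_of_pos hx _

theorem ae_weightMeasure_pos (lam : ℝ) : ∀ᵐ x ∂(weightMeasure lam), 0 < x :=
  (weightMeasure_absolutelyContinuous lam).ae_le (ae_restrict_mem measurableSet_Ioi)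

theorem integrableOn_rpow_mul_cexp_neg_mul {a : ℝ} (ha : 0 < a) {s : ℂ} (hs : 0 < s.re) :
    IntegrableOn (fun x : ℝ => ((x ^ (a - 1) : ℝ) : ℂ) * Complex.exp (-s * x)) (Set.Ioi 0) := by
  have h := integrableOn_rpow_mul_exp_neg_mul_rpow (p := 1) (s := a - 1) (by linarith) one_pos hs
  refine h.mono' (by fun_prop) ?_
  filter_upwards [ae_restrict_mem measurableSet_Ioi] with x hx
  have hx' : 0 ≤ x ^ (a - 1) := Real.rpow_nonneg (le_of_lt hx) _
  simp [Complex.norm_exp, abs_of_nonneg hx']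

/-- For `lam = 2 - a` the density is `x^(a-1)`, so the Gamma integral is a complex moment generating
function, analytic wherever the real part lies in this interior. -/
theorem mem_interior_integrableExpSet {a : ℝ} (ha : 0 < a) {t : ℝ} (ht : t < 0) :
    t ∈ interior (ProbabilityTheory.integrableExpSet id (weightMeasure (2 - a))) := by
  refine interior_maximal (t := Set.Iio (0 : ℝ)) (fun r hr => ?_) isOpen_Iio ht
  rw [ProbabilityTheory.integrableExpSet, Set.mem_ofPred_eq, integrable_weightMeasure_iff]
  have hr' : 0 < -r := by simpa using hr
  have h := integrableOn_rpow_mul_exp_neg_mul_rpow (p := 1) (s := a - 1) (by linarith) one_pos hr'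
  refine h.congr_fun (fun x hx => ?_) measurableSet_Ioi
  simp [show 1 - (2 - a) = a - 1 by ring]

/-- The Gamma integral `∫₀^∞ x ^ (a - 1) exp (-s x) dx = Γ(a) s ^ (-a)` for `Re s > 0`. -/
theorem integral_rpow_mul_cexp_neg_mul {a : ℝ} (ha : 0 < a) {s : ℂ} (hs : 0 < s.re) :
    ∫ x in Set.Ioi (0 : ℝ), ((x ^ (a - 1) : ℝ) : ℂ) * Complex.exp (-s * x) =
      Real.Gamma a * Complex.exp (-a * Complex.log s) := by
  have hM : ∀ s : ℂ, ∫ x in Set.Ioi (0 : ℝ), ((x ^ (a - 1) : ℝ) : ℂ) * Complex.exp (-s * x) =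
      ProbabilityTheory.complexMGF id (weightMeasure (2 - a)) (-s) := fun s => by
    rw [ProbabilityTheory.complexMGF, integral_weightMeasure]
    simp [show 1 - (2 - a) = a - 1 by ring]
  have hopen : IsOpen {s : ℂ | 0 < s.re} := isOpen_lt continuous_const Complex.continuous_re
  have hf : AnalyticOnNhd ℂ
      (fun s => ProbabilityTheory.complexMGF id (weightMeasure (2 - a)) (-s)) {s | 0 < s.re} := by
    intro s hs
    have hs : 0 < s.re := hs
    have := ProbabilityTheory.analyticAt_complexMGF (z := -s) (X := id)
      (μ := weightMeasure (2 - a)) (mem_interior_integrableExpSet ha (by simpa using hs))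
    exact this.comp analyticAt_id.neg
  have hg : AnalyticOnNhd ℂ
      (fun s => (Real.Gamma a : ℂ) * Complex.exp (-a * Complex.log s)) {s | 0 < s.re} := by
    refine DifferentiableOn.analyticOnNhd (fun s hs => ?_) hopen
    have : s ∈ Complex.slitPlane := Or.inl hs
    exact (((differentiableAt_id.clog this).const_mul _).cexp.const_mul _).differentiableWithinAt
  have hU : IsPreconnected {s : ℂ | 0 < s.re} :=
    (convex_halfSpace_re_gt 0).isPreconnected
  have key : ∀ r : ℝ, 0 < r →
      ProbabilityTheory.complexMGF id (weightMeasure (2 - a)) (-(r : ℂ)) =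
        (Real.Gamma a : ℂ) * Complex.exp (-a * Complex.log r) := fun r hr => by
    rw [← hM]
    have := Real.integral_rpow_mul_exp_neg_mul_Ioi ha hr
    rw [← Complex.ofReal_inj, ← integral_complex_ofReal] at this
    push_cast at this
    simp only [← neg_mul] at this
    refine Eq.trans (by simp) (this.trans ?_)
    rw [← Complex.ofReal_log hr.le, mul_comm, one_div, Real.inv_rpow hr.le, ← Real.rpow_neg hr.le,
      Real.rpow_def_of_pos hr]
    push_cast
    ring_nf
  rw [hM]
  -- Both sides are analytic on the right half-plane and agree on the positive reals, which
  -- accumulate at `1`.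
  refine hf.eqOn_of_preconnected_of_frequently_eq hg hU (z₀ := 1) (by simp) ?_ hs
  have ht : Filter.Tendsto (fun r : ℝ => (r : ℂ)) (nhdsWithin 1 {1}ᶜ) (nhdsWithin 1 {1}ᶜ) := by
    refine tendsto_nhdsWithin_iff.2 ⟨?_, ?_⟩
    · exact (Complex.continuous_ofReal.tendsto' 1 1 (by simp)).mono_left nhdsWithin_le_nhds
    · filter_upwards [self_mem_nhdsWithin] with r hr
      simpa using hr
  refine ht.frequently (Filter.Eventually.frequently ?_)
  filter_upwards [nhdsWithin_le_nhds (Ioi_mem_nhds one_pos)] with r hr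
  exact key r hr

/-! ### Reproducing kernels -/

/-- The vector representing the evaluation at `z` of the Fourier--Laplace transform. -/
noncomputable def kernelFun (lam : ℝ) (z : ℍ) (x : ℝ) : ℂ :=
  ((x ^ (lam - 1) : ℝ) : ℂ) * Complex.exp (-Complex.I * (starRingEnd ℂ) (z : ℂ) * x)

/-- The parameter `-i (z - conj w)`, with positive real part. -/
noncomputable def polar (z w : ℍ) : ℂ := -Complex.I * ((z : ℂ) - (starRingEnd ℂ) (w : ℂ))

theorem polar_re (z w : ℍ) : (polar z w).re = z.im + w.im := by
  simp [polar]

theorem polar_re_pos (z w : ℍ) : 0 < (polar z w).re := by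
  rw [polar_re]; exact add_pos z.im_pos w.im_pos

/-- The weight cancels one of the two powers `x^(lam-1)`, leaving a Gamma integrand. The extra
factor `x^k` serves the monomials of the Jacobi polynomial. -/
theorem conj_kernelFun_mul (lam : ℝ) (z w : ℍ) (k : ℕ) {x : ℝ} (hx : 0 < x) :
    ((x ^ (1 - lam) : ℝ) : ℂ) * ((starRingEnd ℂ) (kernelFun lam z x) * (x ^ k * kernelFun lam w x)) =
      ((x ^ (lam + k - 1) : ℝ) : ℂ) * Complex.exp (-polar z w * x) := by
  have h1 : x ^ (lam + k - 1) = x ^ (1 - lam) * x ^ (lam - 1) * x ^ k * x ^ (lam - 1) := by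
    rw [← Real.rpow_add hx, ← Real.rpow_natCast, ← Real.rpow_add hx, ← Real.rpow_add hx]
    congr 1; ring
  have h2 : -polar z w * x = Complex.I * z * x + -Complex.I * (starRingEnd ℂ) (w : ℂ) * x := by
    rw [polar]; ring
  rw [h1, h2, Complex.exp_add, kernelFun, kernelFun]
  simp only [map_mul, Complex.conj_ofReal, ← Complex.exp_conj, map_neg, Complex.conj_I,
    Complex.conj_conj, neg_neg]
  push_cast
  ring

theorem integrable_conj_kernelFun_mul {lam : ℝ} (hl : 1 < lam) (z w : ℍ) (k : ℕ) :
    Integrable (fun x => (starRingEnd ℂ) (kernelFun lam z x) * (x ^ k * kernelFun lam w x))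
      (weightMeasure lam) := by
  rw [integrable_weightMeasure_iff]
  refine (integrableOn_rpow_mul_cexp_neg_mul (a := lam + k) (by positivity)
    (polar_re_pos z w)).congr_fun (fun x hx => ?_) measurableSet_Ioi
  simp only [← conj_kernelFun_mul lam z w k hx, Complex.real_smul]

theorem integral_conj_kernelFun_mul {lam : ℝ} (hl : 1 < lam) (z w : ℍ) (k : ℕ) :
    ∫ x, (starRingEnd ℂ) (kernelFun lam z x) * (x ^ k * kernelFun lam w x) ∂(weightMeasure lam) =
      Real.Gamma (lam + k) * Complex.exp (-(lam + k) * Complex.log (polar z w)) := by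
  have := integral_rpow_mul_cexp_neg_mul (a := lam + k) (by positivity) (polar_re_pos z w)
  push_cast at this
  rw [← this, integral_weightMeasure]
  refine setIntegral_congr_fun measurableSet_Ioi fun x hx => ?_
  exact conj_kernelFun_mul lam z w k hx

theorem measurable_kernelFun (lam : ℝ) (z : ℍ) : Measurable (kernelFun lam z) := by
  unfold kernelFun; fun_prop

theorem memLp_kernelFun {lam : ℝ} (hl : 1 < lam) (z : ℍ) :
    MemLp (kernelFun lam z) 2 (weightMeasure lam) := by
  rw [memLp_two_iff_integrable_sq_norm (measurable_kernelFun lam z).aestronglyMeasurable]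
  refine (integrable_conj_kernelFun_mul hl z z 0).norm.congr (ae_of_all _ fun x => ?_)
  simp [sq]

/-- The vector `kernelFun lam z` of `L2Half lam`. -/
noncomputable def kernelVec {lam : ℝ} (hl : 1 < lam) (z : ℍ) : L2Half lam :=
  (memLp_kernelFun hl z).toLp _

theorem coeFn_kernelVec {lam : ℝ} (hl : 1 < lam) (z : ℍ) :
    kernelVec hl z =ᵐ[weightMeasure lam] kernelFun lam z :=
  MemLp.coeFn_toLp _

theorem inner_kernelVec {lam : ℝ} (hl : 1 < lam) (z : ℍ) (F : L2Half lam) :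
    ⟪kernelVec hl z, F⟫_ℂ = fourierLaplace F z := by
  have : ∀ᵐ x ∂(weightMeasure lam), ⟪kernelVec hl z x, F x⟫_ℂ =
      F x * (starRingEnd ℂ) (kernelFun lam z x) := by
    filter_upwards [coeFn_kernelVec hl z] with x hx
    rw [hx, RCLike.inner_apply]
  rw [L2.inner_def, integral_congr_ae this, integral_weightMeasure, fourierLaplace]
  refine setIntegral_congr_fun measurableSet_Ioi fun x hx => ?_
  have h1 : x ^ (1 - lam) * x ^ (lam - 1) = 1 := by
    rw [← Real.rpow_add hx, sub_add_sub_cancel, sub_self, Real.rpow_zero]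
  have h2 : ((x ^ (1 - lam) : ℝ) : ℂ) * ((x ^ (lam - 1) : ℝ) : ℂ) = 1 := by exact_mod_cast h1
  simp only [kernelFun, map_mul, Complex.conj_ofReal, ← Complex.exp_conj, map_neg, Complex.conj_I,
    Complex.conj_conj, neg_neg]
  linear_combination (F x * Complex.exp (Complex.I * z * x)) * h2

theorem inner_kernelVec_kernelVec {lam : ℝ} (hl : 1 < lam) (z w : ℍ) :
    ⟪kernelVec hl z, kernelVec hl w⟫_ℂ =
      Real.Gamma lam * Complex.exp (-lam * Complex.log (polar z w)) := by
  have h := integral_conj_kernelFun_mul hl z w 0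
  simp only [Nat.cast_zero, add_zero, pow_zero, one_mul] at h
  rw [← h, L2.inner_def]
  refine integral_congr_ae ?_
  filter_upwards [coeFn_kernelVec hl z, coeFn_kernelVec hl w] with x hz hw
  rw [hz, hw, RCLike.inner_apply, mul_comm]

/-- It suffices to pair `f` with test functions `g`. Each `g` is the Fourier transform of a Schwartz
function, and the transform can be moved onto `f`, where it vanishes. -/
theorem ae_eq_zero_of_fourier_eq_zero {f : ℝ → ℂ} (hf : Integrable f)
    (h : ∀ t : ℝ, ∫ x : ℝ, Complex.exp (t * x * Complex.I) * f x = 0) : f =ᵐ[volume] 0 := by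
  have hF : ∀ ξ, VectorFourier.fourierIntegral Real.fourierChar volume (innerₗ ℝ) f ξ = 0 := by
    intro ξ
    rw [← h (-(2 * Real.pi * ξ)), VectorFourier.fourierIntegral]
    refine integral_congr_ae (ae_of_all _ fun x => ?_)
    simp only [Circle.smul_def, Real.fourierChar_apply, innerₗ_apply_apply, smul_eq_mul]
    congr 2
    simp
    ring
  refine ae_eq_zero_of_integral_contDiff_smul_eq_zero hf.locallyIntegrable fun g hg hg' => ?_
  set G : SchwartzMap ℝ ℂ := HasCompactSupport.toSchwartzMap (f := fun x => (g x : ℂ))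
    (hg'.comp_left (g := ((↑) : ℝ → ℂ)) (by simp)) (Complex.ofRealCLM.contDiff.comp hg) with hG
  have hflip := VectorFourier.integral_fourierIntegral_smul_eq_flip (L := innerₗ ℝ)
    (μ := volume) (ν := volume) Real.continuous_fourierChar continuous_inner hf
    (FourierTransformInv.fourierInv G).integrable
  have hGG : ∀ x, VectorFourier.fourierIntegral Real.fourierChar volume (innerₗ ℝ).flip
      (FourierTransformInv.fourierInv G) x = g x := fun x => by
    have h1 : FourierTransform.fourier (FourierTransformInv.fourierInv G) = G :=
      FourierTransform.fourier_fourierInv_eq G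
    have h2 := congrArg (fun S : SchwartzMap ℝ ℂ => S x) h1
    rw [flip_innerₗ]
    exact h2
  simp only [hF, zero_smul, integral_zero, hGG] at hflip
  rw [hflip]
  exact integral_congr_ae (ae_of_all _ fun x => by simp [mul_comm])

/-- On the line `z = t + i` the Fourier–Laplace transform of `F` is the Fourier transform of
`exp(-x) F(x)` on the half-line, so its vanishing forces `F = 0`. -/
theorem isTotal_kernelVec {lam : ℝ} (hl : 1 < lam) : IsTotal (kernelVec hl) := by
  intro F hF
  have hF' : ∀ z : ℍ, fourierLaplace F z = 0 := fun z => by rw [← inner_kernelVec hl, hF]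
  have hmul : ∀ x : ℝ, 0 < x → ((x ^ (1 - lam) : ℝ) : ℂ) *
      ((starRingEnd ℂ) (kernelFun lam UpperHalfPlane.I x) * F x) =
        Complex.exp (-x) * F x := fun x hx => by
    have h1 : x ^ (1 - lam) * x ^ (lam - 1) = 1 := by
      rw [← Real.rpow_add hx, sub_add_sub_cancel, sub_self, Real.rpow_zero]
    have h2 : ((x ^ (1 - lam) : ℝ) : ℂ) * ((x ^ (lam - 1) : ℝ) : ℂ) = 1 := by exact_mod_cast h1
    simp only [kernelFun, map_mul, Complex.conj_ofReal, ← Complex.exp_conj, map_neg, Complex.conj_I,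
      neg_neg, UpperHalfPlane.coe_I, Complex.I_mul_I, neg_mul, one_mul]
    linear_combination (Complex.exp (-x) * F x) * h2
  -- Up to the weight this is the integrand of `⟪k_i, F⟫`, a product of two square-integrable
  -- functions.
  have hint : IntegrableOn (fun x : ℝ => Complex.exp (-x) * F x) (Set.Ioi 0) := by
    have h1 := L2.integrable_inner (𝕜 := ℂ) (kernelVec hl UpperHalfPlane.I) F
    have h2 : Integrable (fun x => (starRingEnd ℂ) (kernelFun lam UpperHalfPlane.I x) * F x)
        (weightMeasure lam) := by
      refine h1.congr ?_
      filter_upwards [coeFn_kernelVec hl UpperHalfPlane.I] with x hx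
      rw [hx, RCLike.inner_apply, mul_comm]
    rw [integrable_weightMeasure_iff] at h2
    refine h2.congr_fun (fun x hx => ?_) measurableSet_Ioi
    simpa only [Complex.real_smul] using hmul x hx
  have hz := ae_eq_zero_of_fourier_eq_zero (hint.integrable_indicator measurableSet_Ioi)
    fun t => by
      rw [← hF' ⟨t + Complex.I, by simp⟩, fourierLaplace, ← integral_indicator measurableSet_Ioi]
      refine integral_congr_ae (ae_of_all _ fun x => ?_)
      by_cases hx : x ∈ Set.Ioi (0 : ℝ)
      · simp only [Set.indicator_of_mem hx]
        rw [← mul_assoc, ← Complex.exp_add, mul_comm]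
        congr 2
        linear_combination -(x : ℂ) * Complex.I_mul_I
      · simp only [Set.indicator_of_notMem hx, mul_zero]
  refine (Lp.eq_zero_iff_ae_eq_zero).2 ((weightMeasure_absolutelyContinuous lam).ae_le ?_)
  refine (ae_restrict_iff' measurableSet_Ioi).2 ?_
  filter_upwards [hz] with x hx hx0
  simpa [Set.indicator_of_mem hx0] using hx

/-! ### Covariance -/

theorem SL2Cover.autoFactor_ne_zero (g : SL2Cover) (z : ℍ) : autoFactor g.toSL z ≠ 0 := by
  rw [← g.exp_logFactor]; exact Complex.exp_ne_zero _

theorem coe_smul_mul_autoFactor (g : SL2Cover) (z : ℍ) :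
    ((g.toSL • z : ℍ) : ℂ) * autoFactor g.toSL z = (g.toSL 0 0 : ℂ) * z + (g.toSL 0 1 : ℂ) := by
  have h := g.autoFactor_ne_zero z
  rw [UpperHalfPlane.coe_specialLinearGroup_apply]
  simp only [Algebra.algebraMap_self, RingHom.id_apply]
  exact div_mul_cancel₀ _ h

/-- The classical identity for `gz - conj (gw)`, a consequence of `det g = 1`. -/
theorem polar_smul_mul (g : SL2Cover) (z w : ℍ) :
    polar (g.toSL • z) (g.toSL • w) *
      (autoFactor g.toSL z * (starRingEnd ℂ) (autoFactor g.toSL w)) = polar z w := by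
  have hz := coe_smul_mul_autoFactor g z
  have hw := congrArg (starRingEnd ℂ) (coe_smul_mul_autoFactor g w)
  have hdet : (g.toSL 0 0 : ℂ) * (g.toSL 1 1 : ℂ) - (g.toSL 0 1 : ℂ) * (g.toSL 1 0 : ℂ) = 1 := by
    have := g.toSL.det_coe
    rw [Matrix.det_fin_two] at this
    exact_mod_cast this
  simp only [map_mul, map_add, Complex.conj_ofReal] at hw
  have hcw : (starRingEnd ℂ) (autoFactor g.toSL w) =
      (g.toSL 1 0 : ℂ) * (starRingEnd ℂ) (w : ℂ) + (g.toSL 1 1 : ℂ) := by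
    simp [autoFactor]
  have hcz : autoFactor g.toSL z = (g.toSL 1 0 : ℂ) * z + (g.toSL 1 1 : ℂ) := rfl
  simp only [polar]
  linear_combination -Complex.I * (starRingEnd ℂ) (autoFactor g.toSL w) * hz +
    Complex.I * autoFactor g.toSL z * hw - Complex.I * ((z : ℂ) - (starRingEnd ℂ) (w : ℂ)) * hdet
    + Complex.I * ((g.toSL 0 0 : ℂ) * (starRingEnd ℂ) (w : ℂ) + (g.toSL 0 1 : ℂ)) * hcz
    - Complex.I * ((g.toSL 0 0 : ℂ) * z + (g.toSL 0 1 : ℂ)) * hcw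

theorem continuous_log_polar : Continuous fun p : ℍ × ℍ => Complex.log (polar p.1 p.2) := by
  refine Continuous.clog ?_ fun p => Or.inl (polar_re_pos _ _)
  unfold polar
  fun_prop

/-- The difference takes values in `2πiℤ`, so the agreement set is also the set where its norm is
less than `2π`. It is closed and open. -/
theorem eq_of_continuous_of_exp_eq {X : Type*} [TopologicalSpace X] [PreconnectedSpace X]
    {f g : X → ℂ} (hf : Continuous f) (hg : Continuous g)
    (h : ∀ x, Complex.exp (f x) = Complex.exp (g x)) {x₀ : X} (h₀ : f x₀ = g x₀) (x : X) :
    f x = g x := by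
  have hset : {x | f x = g x} = {x | ‖f x - g x‖ < 2 * Real.pi} := by
    ext x
    refine ⟨fun hx => ?_, fun hx => ?_⟩
    · have hx : f x = g x := hx
      simpa [hx] using Real.pi_pos
    · have hx : ‖f x - g x‖ < 2 * Real.pi := hx
      obtain ⟨n, hn⟩ := Complex.exp_eq_exp_iff_exists_int.1 (h x)
      rw [hn, add_sub_cancel_left, norm_mul, norm_mul, norm_mul, Complex.norm_intCast] at hx
      have hpi : ‖(2 : ℂ)‖ * ‖(Real.pi : ℂ)‖ * ‖Complex.I‖ = 2 * Real.pi := by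
        simp [abs_of_pos Real.pi_pos]
      rw [hpi] at hx
      have h1 : |(n : ℝ)| < 1 := by
        by_contra! hc
        nlinarith [Real.pi_pos]
      have h2 : n = 0 := by
        have : |n| < 1 := by exact_mod_cast h1
        exact Int.abs_lt_one_iff.1 this
      change f x = g x
      rw [hn, h2]; simp
  have hclopen : IsClopen {x | f x = g x} :=
    ⟨isClosed_eq hf hg, hset ▸ isOpen_lt (hf.sub hg).norm continuous_const⟩
  have := hclopen.eq_univ ⟨x₀, h₀⟩
  exact (this.symm ▸ Set.mem_univ x : x ∈ {x | f x = g x})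

theorem polar_ne_zero (z w : ℍ) : polar z w ≠ 0 := fun h => by
  simpa [h] using polar_re_pos z w

theorem log_polar_self_im (z : ℍ) : (Complex.log (polar z z)).im = 0 := by
  have : polar z z = ((z.im + z.im : ℝ) : ℂ) :=
    Complex.ext (by rw [polar_re, Complex.ofReal_re]) (by simp [polar])
  rw [this, ← Complex.ofReal_log (add_pos z.im_pos z.im_pos).le, Complex.ofReal_im]

theorem exp_log_polar_smul (g : SL2Cover) (z w : ℍ) :
    Complex.exp (Complex.log (polar (g.toSL • z) (g.toSL • w))) =
      Complex.exp (Complex.log (polar z w) - g.logFactor z - (starRingEnd ℂ) (g.logFactor w)) := by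
  rw [Complex.exp_log (polar_ne_zero _ _), Complex.exp_sub, Complex.exp_sub,
    Complex.exp_log (polar_ne_zero _ _), Complex.exp_conj, g.exp_logFactor, g.exp_logFactor,
    ← polar_smul_mul g z w]
  have h1 := g.autoFactor_ne_zero z
  have h2 : (starRingEnd ℂ) (autoFactor g.toSL w) ≠ 0 :=
    (map_ne_zero _).2 (g.autoFactor_ne_zero w)
  rw [div_div, mul_div_cancel_right₀ _ (mul_ne_zero h1 h2)]

/-- On the diagonal both sides are real, and real parts are determined by the norm of the
exponential. -/
theorem log_polar_smul_self (g : SL2Cover) (z : ℍ) :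
    Complex.log (polar (g.toSL • z) (g.toSL • z)) =
      Complex.log (polar z z) - g.logFactor z - (starRingEnd ℂ) (g.logFactor z) := by
  refine Complex.ext ?_ ?_
  · have := congrArg norm (exp_log_polar_smul g z z)
    rwa [Complex.norm_exp, Complex.norm_exp, Real.exp_eq_exp] at this
  · simp [log_polar_self_im]

/-- The exponentials agree by `polar_smul_mul`. The possible jump by `2πi` is excluded by
connectedness of `ℍ × ℍ` and agreement on the diagonal, which fixes the branch for real exponents
`lam`. -/
theorem log_polar_smul (g : SL2Cover) (z w : ℍ) :
    Complex.log (polar (g.toSL • z) (g.toSL • w)) =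
      Complex.log (polar z w) - g.logFactor z - (starRingEnd ℂ) (g.logFactor w) := by
  have hsmul := SL2Cover.continuous_smul_sl g.toSL
  have hpair : Continuous fun p : ℍ × ℍ => (g.toSL • p.1, g.toSL • p.2) :=
    (hsmul.comp continuous_fst).prodMk (hsmul.comp continuous_snd)
  have hf : Continuous fun p : ℍ × ℍ => Complex.log (polar (g.toSL • p.1) (g.toSL • p.2)) := by
    have := continuous_log_polar.comp hpair
    simpa only [Function.comp_def] using this
  have hg : Continuous fun p : ℍ × ℍ =>
      Complex.log (polar p.1 p.2) - g.logFactor p.1 - (starRingEnd ℂ) (g.logFactor p.2) :=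
    (continuous_log_polar.sub (g.continuous_logFactor.comp continuous_fst)).sub
      (Complex.continuous_conj.comp (g.continuous_logFactor.comp continuous_snd))
  have key := fun h₀ => eq_of_continuous_of_exp_eq hf hg (fun p => exp_log_polar_smul g p.1 p.2)
    (x₀ := (z, z)) h₀ (z, w)
  simp only at key
  exact key (log_polar_smul_self g z)

/-! ### The `L²`-model -/

/-- The multiplier by which `g` carries `kernelVec z` to `kernelVec (g • z)`. -/
noncomputable def kernelMultiplier (lam : ℝ) (g : SL2Cover) (z : ℍ) : ℂ :=
  Complex.exp (-lam * (starRingEnd ℂ) (g.logFactor z))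

theorem conj_kernelMultiplier (lam : ℝ) (g : SL2Cover) (z : ℍ) :
    (starRingEnd ℂ) (kernelMultiplier lam g z) = Complex.exp (-lam * g.logFactor z) := by
  simp [kernelMultiplier, ← Complex.exp_conj]

/-- By unitarity `⟪ρ(g) k_z, F⟫ = ⟪k_z, ρ(g⁻¹) F⟫`, the value at `z` of `π(g⁻¹)` applied to the
transform of `F`; this involves `g` itself, and its multiplier is conjugated in the first slot. -/
theorem IsL2Model.apply_kernelVec {lam : ℝ} (hl : 1 < lam)
    {ρ : SL2Cover →* (L2Half lam ≃ₗᵢ[ℂ] L2Half lam)} (hρ : IsL2Model lam ρ) (g : SL2Cover) (z : ℍ) :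
    ρ g (kernelVec hl z) = kernelMultiplier lam g z • kernelVec hl (g.toSL • z) := by
  refine ext_inner_right ℂ fun F => ?_
  rw [← unitaryRep_apply_inv_apply ρ g F, LinearIsometryEquiv.inner_map_map, inner_kernelVec, hρ,
    multiplierAction, inv_inv, unitaryRep_apply_inv_apply, inner_smul_left, conj_kernelMultiplier, inner_kernelVec]

theorem isL2Model_of_apply_kernelVec {lam : ℝ} (hl : 1 < lam)
    {ρ : SL2Cover →* (L2Half lam ≃ₗᵢ[ℂ] L2Half lam)}
    (h : ∀ g z, ρ g (kernelVec hl z) = kernelMultiplier lam g z • kernelVec hl (g.toSL • z)) :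
    IsL2Model lam ρ := by
  intro g F z
  rw [← inner_kernelVec hl, ← (ρ g⁻¹).inner_map_map, h,
    unitaryRep_inv_apply_apply, inner_smul_left, conj_kernelMultiplier,
    inner_kernelVec, multiplierAction]

theorem existsUnique_isL2Model {lam : ℝ} (hl : 1 < lam) : ∃! ρ, IsL2Model lam ρ := by
  refine existsUnique_of_exists_of_unique ?_ fun ρ₁ ρ₂ h₁ h₂ => ?_
  · have hgram : ∀ (g : SL2Cover) (z w : ℍ),
        ⟪kernelMultiplier lam g z • kernelVec hl (g.toSL • z),
          kernelMultiplier lam g w • kernelVec hl (g.toSL • w)⟫_ℂ =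
            ⟪kernelVec hl z, kernelVec hl w⟫_ℂ := fun g z w => by
      rw [inner_smul_left, inner_smul_right, conj_kernelMultiplier, inner_kernelVec_kernelVec,
        inner_kernelVec_kernelVec, log_polar_smul, kernelMultiplier]
      have : Complex.exp (-lam * Complex.log (polar z w)) = Complex.exp (-lam * g.logFactor z) *
          Complex.exp (-lam * (starRingEnd ℂ) (g.logFactor w)) * Complex.exp (-lam *
            (Complex.log (polar z w) - g.logFactor z - (starRingEnd ℂ) (g.logFactor w))) := by
        rw [← Complex.exp_add, ← Complex.exp_add]
        congr 1
        ring
      rw [this]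
      ring
    have hone : (fun z => kernelMultiplier lam 1 z • kernelVec hl ((1 : SL2Cover).toSL • z)) =
        kernelVec hl := by
      funext z
      simp [kernelMultiplier]
    obtain ⟨ρ, hρ⟩ := (isTotal_kernelVec hl).exists_unitaryRep
      (fun (g : SL2Cover) z => kernelMultiplier lam g z • kernelVec hl (g.toSL • z)) hgram hone
      -- The multiplier is a cocycle because the logarithms add under the group law.
      fun g h z => ⟨kernelMultiplier lam h z, h.toSL • z, rfl, by
        rw [smul_smul, SL2Cover.mul_toSL, mul_smul]
        congr 1
        rw [kernelMultiplier, kernelMultiplier, kernelMultiplier, ← Complex.exp_add,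
          SL2Cover.mul_logFactor, map_add]
        congr 1
        ring⟩
    exact ⟨ρ, isL2Model_of_apply_kernelVec hl hρ⟩
  · ext1 g
    exact (isTotal_kernelVec hl).eq_of_forall_apply_eq' fun z => by
      rw [h₁.apply_kernelVec hl, h₂.apply_kernelVec hl]

/-! ### Tensor products -/

/-- Induction from the π-system of rectangles; the total integral, itself over a rectangle, handles
complements. -/
theorem setIntegral_eq_zero_of_forall_prod {α β : Type*} [MeasurableSpace α] [MeasurableSpace β]
    {E : Type*} [NormedAddCommGroup E] [NormedSpace ℝ E] {μ : Measure (α × β)} {f : α × β → E}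
    (hf : Integrable f μ)
    (h : ∀ (s : Set α) (t : Set β), MeasurableSet s → MeasurableSet t → ∫ x in s ×ˢ t, f x ∂μ = 0)
    {u : Set (α × β)} (hu : MeasurableSet u) : ∫ x in u, f x ∂μ = 0 := by
  have huniv : ∫ x, f x ∂μ = 0 := by
    simpa using h Set.univ Set.univ MeasurableSet.univ MeasurableSet.univ
  induction u, hu using MeasurableSpace.induction_on_inter generateFrom_prod.symm
    isPiSystem_prod with
  | empty => simp
  | basic u hu =>
    obtain ⟨s, hs, t, ht, rfl⟩ := hu
    exact h s t hs ht
  | compl u hu ih =>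
    rw [← sub_eq_zero.2 huniv, ← integral_add_compl hu hf, ih]
    simp
  | iUnion u hd hu ih =>
    rw [integral_iUnion hu hd hf.integrableOn]
    simp [ih]

theorem ae_eq_zero_of_forall_setIntegral_prod_eq_zero {α β : Type*} [MeasurableSpace α]
    [MeasurableSpace β] {E : Type*} [NormedAddCommGroup E] [NormedSpace ℝ E] [CompleteSpace E]
    {μ : Measure α} {ν : Measure β} [SigmaFinite μ] [SigmaFinite ν] {f : α × β → E}
    (hf : ∀ (s : Set α) (t : Set β), MeasurableSet s → MeasurableSet t → μ s < ⊤ → ν t < ⊤ →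
      IntegrableOn f (s ×ˢ t) (μ.prod ν))
    (h : ∀ (s : Set α) (t : Set β), MeasurableSet s → MeasurableSet t → μ s < ⊤ → ν t < ⊤ →
      ∫ x in s ×ˢ t, f x ∂(μ.prod ν) = 0) : f =ᵐ[μ.prod ν] 0 := by
  set S := spanningSets μ
  set T := spanningSets ν
  have hS := measurableSet_spanningSets μ
  have hT := measurableSet_spanningSets ν
  have hn : ∀ n, f =ᵐ[(μ.prod ν).restrict (S n ×ˢ T n)] 0 := fun n => by
    have hint := hf (S n) (T n) (hS n) (hT n) (measure_spanningSets_lt_top μ n)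
      (measure_spanningSets_lt_top ν n)
    refine hint.ae_eq_zero_of_forall_setIntegral_eq_zero fun u hu _ => ?_
    refine setIntegral_eq_zero_of_forall_prod hint (fun s t hs ht => ?_) hu
    rw [Measure.restrict_restrict (hs.prod ht), Set.prod_inter_prod]
    exact h _ _ (hs.inter (hS n)) (ht.inter (hT n))
      ((measure_mono Set.inter_subset_right).trans_lt (measure_spanningSets_lt_top μ n))
      ((measure_mono Set.inter_subset_right).trans_lt (measure_spanningSets_lt_top ν n))
  have hun : ⋃ n, S n ×ˢ T n = Set.univ := by
    rw [Set.iUnion_prod_of_monotone (monotone_spanningSets μ) (monotone_spanningSets ν),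
      iUnion_spanningSets, iUnion_spanningSets, Set.univ_prod_univ]
  rw [← Measure.restrict_univ (μ := μ.prod ν), ← hun]
  exact (ae_restrict_iUnion_iff _ _).2 hn

section Tensor

variable {lam₁ lam₂ : ℝ}

theorem coeFn_tensor (u : L2Half lam₁) (v : L2Half lam₂) :
    tensor u v =ᵐ[(weightMeasure lam₁).prod (weightMeasure lam₂)] fun p => u p.1 * v p.2 :=
  MemLp.coeFn_toLp _

theorem inner_tensor_tensor (u u' : L2Half lam₁) (v v' : L2Half lam₂) :
    ⟪tensor u v, tensor u' v'⟫_ℂ = ⟪u, u'⟫_ℂ * ⟪v, v'⟫_ℂ := by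
  rw [L2.inner_def, L2.inner_def, L2.inner_def, ← integral_prod_mul]
  refine integral_congr_ae ?_
  filter_upwards [coeFn_tensor u v, coeFn_tensor u' v'] with p h h'
  simp only [h, h', RCLike.inner_apply, map_mul]
  ring

theorem norm_tensor (u : L2Half lam₁) (v : L2Half lam₂) : ‖tensor u v‖ = ‖u‖ * ‖v‖ := by
  have h := inner_tensor_tensor u u v v
  simp only [inner_self_eq_norm_sq_to_K] at h
  have h' : ‖tensor u v‖ ^ 2 = (‖u‖ * ‖v‖) ^ 2 := by rw [mul_pow]; exact_mod_cast h
  exact (pow_left_inj₀ (norm_nonneg _) (by positivity) two_ne_zero).1 h'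

theorem ae_prod_fst {p : ℝ → Prop} (h : ∀ᵐ x ∂(weightMeasure lam₁), p x) :
    ∀ᵐ x ∂((weightMeasure lam₁).prod (weightMeasure lam₂)), p x.1 :=
  Measure.quasiMeasurePreserving_fst.ae h

theorem ae_prod_snd {p : ℝ → Prop} (h : ∀ᵐ x ∂(weightMeasure lam₂), p x) :
    ∀ᵐ x ∂((weightMeasure lam₁).prod (weightMeasure lam₂)), p x.2 :=
  Measure.quasiMeasurePreserving_snd.ae h

theorem tensor_add_left (u u' : L2Half lam₁) (v : L2Half lam₂) :
    tensor (u + u') v = tensor u v + tensor u' v := by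
  refine Lp.ext ?_
  filter_upwards [coeFn_tensor (u + u') v, coeFn_tensor u v, coeFn_tensor u' v,
    Lp.coeFn_add (tensor u v) (tensor u' v), ae_prod_fst (Lp.coeFn_add u u')] with p h₁ h₂ h₃ h₄ h₅
  rw [h₁, h₄, Pi.add_apply, h₂, h₃, h₅, Pi.add_apply, add_mul]

theorem tensor_smul_left (c : ℂ) (u : L2Half lam₁) (v : L2Half lam₂) :
    tensor (c • u) v = c • tensor u v := by
  refine Lp.ext ?_
  filter_upwards [coeFn_tensor (c • u) v, coeFn_tensor u v, Lp.coeFn_smul c (tensor u v),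
    ae_prod_fst (Lp.coeFn_smul c u)] with p h₁ h₂ h₃ h₄
  rw [h₁, h₃, Pi.smul_apply, h₂, h₄, Pi.smul_apply, smul_eq_mul, smul_eq_mul, mul_assoc]

theorem tensor_add_right (u : L2Half lam₁) (v v' : L2Half lam₂) :
    tensor u (v + v') = tensor u v + tensor u v' := by
  refine Lp.ext ?_
  filter_upwards [coeFn_tensor u (v + v'), coeFn_tensor u v, coeFn_tensor u v',
    Lp.coeFn_add (tensor u v) (tensor u v'), ae_prod_snd (Lp.coeFn_add v v')] with p h₁ h₂ h₃ h₄ h₅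
  rw [h₁, h₄, Pi.add_apply, h₂, h₃, h₅, Pi.add_apply, mul_add]

theorem tensor_smul_right (c : ℂ) (u : L2Half lam₁) (v : L2Half lam₂) :
    tensor u (c • v) = c • tensor u v := by
  refine Lp.ext ?_
  filter_upwards [coeFn_tensor u (c • v), coeFn_tensor u v, Lp.coeFn_smul c (tensor u v),
    ae_prod_snd (Lp.coeFn_smul c v)] with p h₁ h₂ h₃ h₄
  rw [h₁, h₃, Pi.smul_apply, h₂, h₄, Pi.smul_apply, smul_eq_mul, smul_eq_mul, mul_left_comm]

/-- The continuous bilinear map `tensor`. -/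
noncomputable def tensorCLM (lam₁ lam₂ : ℝ) :
    L2Half lam₁ →L[ℂ] L2Half lam₂ →L[ℂ] L2Quadrant lam₁ lam₂ :=
  LinearMap.mkContinuous₂
    (LinearMap.mk₂ ℂ tensor tensor_add_left tensor_smul_left tensor_add_right tensor_smul_right) 1
    fun u v => by simp [norm_tensor]

theorem tensorCLM_apply (u : L2Half lam₁) (v : L2Half lam₂) :
    tensorCLM lam₁ lam₂ u v = tensor u v := rfl

theorem isTotal_tensor : IsTotal fun p : L2Half lam₁ × L2Half lam₂ => tensor p.1 p.2 := by
  intro G hG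
  refine Lp.eq_zero_iff_ae_eq_zero.2 (ae_eq_zero_of_forall_setIntegral_prod_eq_zero ?_ ?_)
  · intro s t _ _ hs ht
    refine integrableOn_Lp_of_measure_ne_top G one_le_two ?_
    rw [Measure.prod_prod]
    exact (ENNReal.mul_lt_top hs ht).ne
  · intro s t hs ht hμs hμt
    -- The integral over a rectangle is the inner product with a tensor of two indicators.
    rw [← hG (indicatorConstLp 2 hs hμs.ne 1, indicatorConstLp 2 ht hμt.ne 1), L2.inner_def,
      ← integral_indicator (hs.prod ht)]
    refine integral_congr_ae ?_
    filter_upwards [coeFn_tensor (indicatorConstLp 2 hs hμs.ne (1 : ℂ))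
      (indicatorConstLp 2 ht hμt.ne (1 : ℂ)),
      ae_prod_fst (indicatorConstLp_coeFn (p := 2) (hs := hs) (hμs := hμs.ne) (c := (1 : ℂ))),
      ae_prod_snd (indicatorConstLp_coeFn (p := 2) (hs := ht) (hμs := hμt.ne) (c := (1 : ℂ)))]
      with p h₁ h₂ h₃
    rw [h₁, h₂, h₃, RCLike.inner_apply]
    by_cases hp₁ : p.1 ∈ s <;> by_cases hp₂ : p.2 ∈ t <;> simp [Set.indicator, hp₁, hp₂]

/-- The functional `u ⊗ v ↦ ⟪G, u ⊗ v⟫` is continuous in each slot, so its vanishing extends first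
from the `e i` to all `u`, then from the `f j` to all `v`. -/
theorem IsTotal.tensor {ι κ : Type*} {e : ι → L2Half lam₁} {f : κ → L2Half lam₂}
    (he : IsTotal e) (hf : IsTotal f) :
    IsTotal fun p : ι × κ => Holographic.tensor (e p.1) (f p.2) := by
  intro G hG
  have h₁ : ∀ j u, ⟪G, Holographic.tensor u (f j)⟫_ℂ = 0 := fun j u => by
    have := he.eq_of_forall_apply_eq
      (S := (innerSL ℂ G).comp ((tensorCLM lam₁ lam₂).flip (f j))) (T := 0) fun i => by
        have := inner_eq_zero_symm.1 (hG (i, j))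
        simpa [tensorCLM_apply] using this
    simpa [tensorCLM_apply] using congrArg (fun A : L2Half lam₁ →L[ℂ] ℂ => A u) this
  refine isTotal_tensor G fun p => inner_eq_zero_symm.1 ?_
  have := hf.eq_of_forall_apply_eq
    (S := (innerSL ℂ G).comp (tensorCLM lam₁ lam₂ p.1)) (T := 0) fun j => by
      simpa [tensorCLM_apply] using h₁ j p.1
  simpa [tensorCLM_apply] using congrArg (fun A : L2Half lam₂ →L[ℂ] ℂ => A p.2) this

theorem existsUnique_isTensorProductRep (ρ₁ : SL2Cover →* (L2Half lam₁ ≃ₗᵢ[ℂ] L2Half lam₁))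
    (ρ₂ : SL2Cover →* (L2Half lam₂ ≃ₗᵢ[ℂ] L2Half lam₂)) : ∃! τ, IsTensorProductRep ρ₁ ρ₂ τ := by
  refine existsUnique_of_exists_of_unique ?_ fun τ₁ τ₂ h₁ h₂ => ?_
  · obtain ⟨τ, hτ⟩ := (isTotal_tensor (lam₁ := lam₁) (lam₂ := lam₂)).exists_unitaryRep
      (fun (g : SL2Cover) p => tensor (ρ₁ g p.1) (ρ₂ g p.2))
      (fun g p q => by
        rw [inner_tensor_tensor, inner_tensor_tensor, LinearIsometryEquiv.inner_map_map,
          LinearIsometryEquiv.inner_map_map])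
      (by simp)
      fun g h p => ⟨1, (ρ₁ h p.1, ρ₂ h p.2), by simp, by simp⟩
    exact ⟨τ, fun g u v => hτ g (u, v)⟩
  · ext1 g
    exact isTotal_tensor.eq_of_forall_apply_eq' fun p => by rw [h₁, h₂]

end Tensor

/-! ### The holographic operator -/

/-- The shear `(x, y) ↦ (x, x + y)` preserves Lebesgue measure, and the slice of the image of the
quadrant at height `s` is the interval `(0, s)`, of length `s`. -/
theorem lintegral_quadrant_comp_add {q : ℝ → ENNReal} (hq : Measurable q) :
    ∫⁻ p in Set.Ioi (0 : ℝ) ×ˢ Set.Ioi (0 : ℝ), q (p.1 + p.2) =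
      ∫⁻ s in Set.Ioi (0 : ℝ), ENNReal.ofReal s * q s := by
  have hm : MeasurableSet {p : ℝ × ℝ | 0 < p.1 ∧ p.1 < p.2} :=
    (measurableSet_lt measurable_const measurable_fst).inter
      (measurableSet_lt measurable_fst measurable_snd)
  have hF : Measurable ({p : ℝ × ℝ | 0 < p.1 ∧ p.1 < p.2}.indicator fun p => q p.2) :=
    (hq.comp measurable_snd).indicator hm
  have h₁ := (measurePreserving_prod_add (volume : Measure ℝ) (volume : Measure ℝ)).lintegral_comp hF
  rw [← lintegral_indicator (measurableSet_Ioi.prod measurableSet_Ioi),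
    ← lintegral_indicator measurableSet_Ioi]
  calc _ = ∫⁻ p, {p : ℝ × ℝ | 0 < p.1 ∧ p.1 < p.2}.indicator (fun p => q p.2) (p.1, p.1 + p.2)
          ∂((volume : Measure ℝ).prod volume) := by
        rw [Measure.volume_eq_prod]
        refine lintegral_congr fun p => ?_
        simp [Set.indicator]
    _ = _ := by
        rw [h₁, lintegral_prod_symm _ hF.aemeasurable]
        refine lintegral_congr fun s => ?_
        have : ∀ x, {p : ℝ × ℝ | 0 < p.1 ∧ p.1 < p.2}.indicator (fun p => q p.2) (x, s) =
            (Set.Ioo 0 s).indicator (fun _ => q s) x := fun x => by simp [Set.indicator]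
        simp_rw [this]
        rw [lintegral_indicator_const measurableSet_Ioo, Real.volume_Ioo, sub_zero, mul_comm]
        by_cases hs : 0 < s
        · rw [Set.indicator_of_mem (Set.mem_Ioi.2 hs)]
        · rw [Set.indicator_of_notMem (by simpa using hs),
            ENNReal.ofReal_of_nonpos (not_lt.1 hs), zero_mul]

theorem weightMeasure_prod (lam₁ lam₂ : ℝ) :
    (weightMeasure lam₁).prod (weightMeasure lam₂) =
      (volume.restrict (Set.Ioi (0 : ℝ) ×ˢ Set.Ioi (0 : ℝ))).withDensity fun p =>
        ENNReal.ofReal (p.1 ^ (1 - lam₁)) * ENNReal.ofReal (p.2 ^ (1 - lam₂)) := by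
  rw [weightMeasure, weightMeasure, prod_withDensity (by fun_prop) (by fun_prop),
    Measure.prod_restrict, Measure.volume_eq_prod]

/-- Ensures that `h(x + y)` depends only on the almost-everywhere class of `h`. -/
theorem quasiMeasurePreserving_add (lam₁ lam₂ lam₃ : ℝ) :
    Measure.QuasiMeasurePreserving (fun p : ℝ × ℝ => p.1 + p.2)
      ((weightMeasure lam₁).prod (weightMeasure lam₂)) (weightMeasure lam₃) := by
  refine ⟨by fun_prop, Measure.AbsolutelyContinuous.mk fun s hs h0 => ?_⟩
  have hq : Measurable (s.indicator (1 : ℝ → ENNReal)) := measurable_one.indicator hs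
  rw [Measure.map_apply (by fun_prop) hs, weightMeasure_prod]
  refine withDensity_absolutelyContinuous _ _ ?_
  have hs' : MeasurableSet ((fun p : ℝ × ℝ => p.1 + p.2) ⁻¹' s) := by measurability
  have h1 := lintegral_quadrant_comp_add hq
  have h2 : ∫⁻ x in Set.Ioi (0 : ℝ), ENNReal.ofReal x * s.indicator 1 x = 0 := by
    rw [lintegral_eq_zero_iff (by fun_prop)]
    have := restrict_absolutelyContinuous_weightMeasure lam₃ h0
    filter_upwards [measure_eq_zero_iff_ae_notMem.1 this] with x hx
    simp [hx]
  rw [h2, lintegral_eq_zero_iff (by fun_prop)] at h1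
  rw [measure_eq_zero_iff_ae_notMem]
  filter_upwards [h1] with p hp hps
  simp [Set.indicator_of_mem (show p.1 + p.2 ∈ s from hps)] at hp

theorem continuous_jacobiP (ℓ : ℕ) (α β : ℝ) : Continuous (jacobiP ℓ α β) := by
  unfold jacobiP; fun_prop

theorem exists_jacobiP_bound (ℓ : ℕ) (α β : ℝ) :
    ∃ C, 0 ≤ C ∧ ∀ t ∈ Set.Icc (-1 : ℝ) 1, |jacobiP ℓ α β t| ≤ C := by
  obtain ⟨C, hC⟩ := isCompact_Icc.exists_bound_of_continuousOn
    (continuous_jacobiP ℓ α β).continuousOn (s := Set.Icc (-1 : ℝ) 1)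
  exact ⟨C, (norm_nonneg _).trans (hC 0 (by norm_num)), hC⟩

theorem measurable_holographicFun {lam₁ lam₂ : ℝ} {ℓ : ℕ} {h : ℝ → ℂ} (hh : Measurable h) :
    Measurable (holographicFun lam₁ lam₂ ℓ h) := by
  have := (continuous_jacobiP ℓ (lam₁ - 1) (lam₂ - 1)).measurable
  unfold holographicFun
  fun_prop

/-- The argument of the Jacobi polynomial stays in `[-1, 1]`, and after cancelling the weights the
nonnegative powers of `x` and `y` are bounded by those of `x + y`. The remaining exponent is `-lam₁
- lam₂ - 2ℓ = -lam₃`; the segment length `s` later supplies the missing power in `s^(1 - lam₃)`. -/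
theorem holographic_weight_le {lam₁ lam₂ lam₃ : ℝ} (h₁ : 1 < lam₁) (h₂ : 1 < lam₂) {ℓ : ℕ}
    (hℓ : (ℓ : ℝ) = (lam₃ - lam₁ - lam₂) / 2) {C : ℝ}
    (hC : ∀ t ∈ Set.Icc (-1 : ℝ) 1, |jacobiP ℓ (lam₁ - 1) (lam₂ - 1) t| ≤ C)
    {x y : ℝ} (hx : 0 < x) (hy : 0 < y) :
    x ^ (1 - lam₁) * y ^ (1 - lam₂) * (x ^ (lam₁ - 1) * y ^ (lam₂ - 1) *
      (x + y) ^ (-lam₁ - lam₂ - ℓ + 1) *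
      jacobiP ℓ (lam₁ - 1) (lam₂ - 1) ((y - x) / (x + y))) ^ 2 ≤ C ^ 2 * (x + y) ^ (-lam₃) := by
  have hs : 0 < x + y := add_pos hx hy
  set s := x + y
  set P := jacobiP ℓ (lam₁ - 1) (lam₂ - 1) ((y - x) / s)
  have hP : P ^ 2 ≤ C ^ 2 := by
    refine sq_le_sq' ?_ ?_ <;> have := abs_le.1 (hC ((y - x) / s)
      ⟨by rw [le_div_iff₀ hs]; simp only [s]; linarith,
        by rw [div_le_iff₀ hs]; simp only [s]; linarith⟩)
    · exact this.1
    · exact this.2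
  have e1 : x ^ (1 - lam₁) * x ^ (lam₁ - 1) = 1 := by
    rw [← Real.rpow_add hx, sub_add_sub_cancel, sub_self, Real.rpow_zero]
  have e2 : y ^ (1 - lam₂) * y ^ (lam₂ - 1) = 1 := by
    rw [← Real.rpow_add hy, sub_add_sub_cancel, sub_self, Real.rpow_zero]
  have e3 : s ^ (-lam₃) = s ^ (lam₁ - 1) * s ^ (lam₂ - 1) * (s ^ (-lam₁ - lam₂ - ℓ + 1)) ^ 2 := by
    rw [sq, ← Real.rpow_add hs, ← Real.rpow_add hs, ← Real.rpow_add hs]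
    congr 1
    linarith
  have e4 : x ^ (lam₁ - 1) ≤ s ^ (lam₁ - 1) :=
    Real.rpow_le_rpow hx.le (by simp only [s]; linarith) (by linarith)
  have e5 : y ^ (lam₂ - 1) ≤ s ^ (lam₂ - 1) :=
    Real.rpow_le_rpow hy.le (by simp only [s]; linarith) (by linarith)
  calc _ = (x ^ (1 - lam₁) * x ^ (lam₁ - 1)) * (y ^ (1 - lam₂) * y ^ (lam₂ - 1)) *
        (P ^ 2 * (x ^ (lam₁ - 1) * y ^ (lam₂ - 1) * (s ^ (-lam₁ - lam₂ - ℓ + 1)) ^ 2)) := by ring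
    _ ≤ _ := by
      rw [e1, e2, e3, one_mul, one_mul]
      gcongr

theorem lintegral_holographicFun_le {lam₁ lam₂ lam₃ : ℝ} (h₁ : 1 < lam₁) (h₂ : 1 < lam₂) {ℓ : ℕ}
    (hℓ : (ℓ : ℝ) = (lam₃ - lam₁ - lam₂) / 2) {C : ℝ}
    (hC : ∀ t ∈ Set.Icc (-1 : ℝ) 1, |jacobiP ℓ (lam₁ - 1) (lam₂ - 1) t| ≤ C)
    {h : ℝ → ℂ} (hh : Measurable h) :
    ∫⁻ p, ‖holographicFun lam₁ lam₂ ℓ h p‖ₑ ^ 2 ∂((weightMeasure lam₁).prod (weightMeasure lam₂)) ≤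
      ENNReal.ofReal (C ^ 2) * ∫⁻ x, ‖h x‖ₑ ^ 2 ∂(weightMeasure lam₃) := by
  have hm := measurable_holographicFun (lam₁ := lam₁) (lam₂ := lam₂) (ℓ := ℓ) hh
  rw [weightMeasure_prod, lintegral_withDensity_eq_lintegral_mul _ (by fun_prop) (by fun_prop),
    weightMeasure, lintegral_withDensity_eq_lintegral_mul _ (by fun_prop) (by fun_prop),
    ← lintegral_const_mul _ (by fun_prop)]
  calc _ ≤ ∫⁻ p in Set.Ioi (0 : ℝ) ×ˢ Set.Ioi (0 : ℝ), (fun s => ENNReal.ofReal (C ^ 2) *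
        (ENNReal.ofReal (s ^ (-lam₃)) * ‖h s‖ₑ ^ 2)) (p.1 + p.2) := by
        refine setLIntegral_mono' (measurableSet_Ioi.prod measurableSet_Ioi) fun p hp => ?_
        have hx : 0 < p.1 := hp.1
        have hy : 0 < p.2 := hp.2
        simp only [Pi.mul_apply, holographicFun, enorm_mul, mul_pow]
        rw [← mul_assoc, ← mul_assoc]
        refine mul_le_mul_left ?_ _
        rw [← ENNReal.ofReal_mul (by positivity), ← ENNReal.ofReal_mul (by positivity),
          ← ofReal_norm, Complex.norm_real, ← ENNReal.ofReal_pow (norm_nonneg _),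
          Real.norm_eq_abs, sq_abs, ← ENNReal.ofReal_mul (by positivity)]
        exact ENNReal.ofReal_le_ofReal (holographic_weight_le h₁ h₂ hℓ hC hx hy)
    _ = _ := by
        refine (lintegral_quadrant_comp_add (q := fun s => ENNReal.ofReal (C ^ 2) *
          (ENNReal.ofReal (s ^ (-lam₃)) * ‖h s‖ₑ ^ 2)) (by fun_prop)).trans ?_
        refine setLIntegral_congr_fun measurableSet_Ioi fun s hs => ?_
        have hs : 0 < s := hs
        have : s ^ (1 - lam₃) = s * s ^ (-lam₃) := by
          rw [sub_eq_add_neg, Real.rpow_add hs, Real.rpow_one]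
        simp only [Pi.mul_apply]
        rw [this, ENNReal.ofReal_mul hs.le]
        ring

theorem eLpNorm_two_eq {α : Type*} [MeasurableSpace α] (μ : Measure α) (f : α → ℂ) :
    eLpNorm f 2 μ = (∫⁻ x, ‖f x‖ₑ ^ 2 ∂μ) ^ (1 / 2 : ℝ) := by
  rw [eLpNorm_eq_lintegral_rpow_enorm_toReal two_ne_zero ENNReal.ofNat_ne_top]
  simp

theorem eLpNorm_two_le_of_lintegral_le {α β : Type*} [MeasurableSpace α] [MeasurableSpace β]
    {μ : Measure α} {ν : Measure β} {f : α → ℂ} {g : β → ℂ} {C : ℝ} (hC : 0 ≤ C)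
    (h : ∫⁻ x, ‖f x‖ₑ ^ 2 ∂μ ≤ ENNReal.ofReal (C ^ 2) * ∫⁻ x, ‖g x‖ₑ ^ 2 ∂ν) :
    eLpNorm f 2 μ ≤ ENNReal.ofReal C * eLpNorm g 2 ν := by
  rw [eLpNorm_two_eq, eLpNorm_two_eq]
  refine (ENNReal.rpow_le_rpow h (by norm_num)).trans_eq ?_
  rw [ENNReal.mul_rpow_of_nonneg _ _ (by norm_num), ENNReal.ofReal_pow hC, ← ENNReal.rpow_natCast,
    ← ENNReal.rpow_mul]
  norm_num

theorem exists_eLpNorm_holographicFun_le {lam₁ lam₂ lam₃ : ℝ} (h₁ : 1 < lam₁) (h₂ : 1 < lam₂)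
    {ℓ : ℕ} (hℓ : (ℓ : ℝ) = (lam₃ - lam₁ - lam₂) / 2) :
    ∃ C : ℝ, 0 ≤ C ∧ ∀ h : L2Half lam₃, eLpNorm (holographicFun lam₁ lam₂ ℓ h) 2
      ((weightMeasure lam₁).prod (weightMeasure lam₂)) ≤
        ENNReal.ofReal C * eLpNorm h 2 (weightMeasure lam₃) := by
  obtain ⟨C, hC0, hC⟩ := exists_jacobiP_bound ℓ (lam₁ - 1) (lam₂ - 1)
  exact ⟨C, hC0, fun h => eLpNorm_two_le_of_lintegral_le hC0
    (lintegral_holographicFun_le h₁ h₂ hℓ hC (Lp.stronglyMeasurable h).measurable)⟩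

theorem memLp_holographicFun {lam₁ lam₂ lam₃ : ℝ} (h₁ : 1 < lam₁) (h₂ : 1 < lam₂)
    {ℓ : ℕ} (hℓ : (ℓ : ℝ) = (lam₃ - lam₁ - lam₂) / 2) (h : L2Half lam₃) :
    MemLp (holographicFun lam₁ lam₂ ℓ h) 2
      ((weightMeasure lam₁).prod (weightMeasure lam₂)) := by
  obtain ⟨C, -, hC⟩ := exists_eLpNorm_holographicFun_le h₁ h₂ hℓ
  exact ⟨(measurable_holographicFun (Lp.stronglyMeasurable h).measurable).aestronglyMeasurable,
    (hC h).trans_lt (ENNReal.mul_lt_top ENNReal.ofReal_lt_top (Lp.memLp h).2)⟩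

theorem holographicFun_congr_ae {lam₁ lam₂ lam₃ : ℝ} {ℓ : ℕ} {h h' : ℝ → ℂ}
    (hh : h =ᵐ[weightMeasure lam₃] h') :
    holographicFun lam₁ lam₂ ℓ h =ᵐ[(weightMeasure lam₁).prod (weightMeasure lam₂)]
      holographicFun lam₁ lam₂ ℓ h' := by
  filter_upwards [(quasiMeasurePreserving_add lam₁ lam₂ lam₃).ae hh] with p hp
  rw [holographicFun, holographicFun, hp]

/-- The formula `holographicFun` defines a bounded operator. -/
theorem exists_holographicOp {lam₁ lam₂ lam₃ : ℝ} (h₁ : 1 < lam₁) (h₂ : 1 < lam₂)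
    {ℓ : ℕ} (hℓ : (ℓ : ℝ) = (lam₃ - lam₁ - lam₂) / 2) :
    ∃ Φ : L2Half lam₃ →L[ℂ] L2Quadrant lam₁ lam₂, ∀ h : L2Half lam₃,
      Φ h =ᵐ[(weightMeasure lam₁).prod (weightMeasure lam₂)] holographicFun lam₁ lam₂ ℓ h := by
  obtain ⟨C, hC0, hC⟩ := exists_eLpNorm_holographicFun_le h₁ h₂ hℓ
  have hmem := memLp_holographicFun h₁ h₂ hℓ
  refine ⟨LinearMap.mkContinuous
    { toFun := fun h => (hmem h).toLp _
      map_add' := fun h h' => ?_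
      map_smul' := fun c h => ?_ } C fun h => ?_, fun h => (hmem h).coeFn_toLp⟩
  · rw [← MemLp.toLp_add, MemLp.toLp_eq_toLp_iff]
    refine (holographicFun_congr_ae (Lp.coeFn_add h h')).trans (ae_of_all _ fun p => ?_)
    simp [holographicFun, mul_add]
  · rw [RingHom.id_apply, ← MemLp.toLp_const_smul, MemLp.toLp_eq_toLp_iff]
    refine (holographicFun_congr_ae (Lp.coeFn_smul c h)).trans (ae_of_all _ fun p => ?_)
    simp [holographicFun, mul_left_comm]
  · change ‖(hmem h).toLp _‖ ≤ _
    rw [Lp.norm_toLp, Lp.norm_def, ← ENNReal.toReal_ofReal hC0, ← ENNReal.toReal_mul]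
    exact ENNReal.toReal_mono (ENNReal.mul_ne_top ENNReal.ofReal_ne_top (Lp.memLp h).2.ne) (hC h)

/-! ### Jacobi polynomials -/

theorem descPochhammer_smeval_eq_eval (r : ℝ) (k : ℕ) :
    (descPochhammer ℤ k).smeval r = (ascPochhammer ℝ k).eval (r - k + 1) := by
  rw [Polynomial.descPochhammer_smeval_eq_ascPochhammer,
    Polynomial.ascPochhammer_smeval_eq_eval]

/-- The Chu--Vandermonde identity for rising factorials. -/
theorem ascPochhammer_eval_add (r s : ℝ) (k : ℕ) :
    (ascPochhammer ℝ k).eval (r + s - k + 1) = ∑ i ∈ Finset.range (k + 1),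
      (k.choose i : ℝ) * ((ascPochhammer ℝ i).eval (r - i + 1) *
        (ascPochhammer ℝ (k - i)).eval (s - (k - i : ℕ) + 1)) := by
  have := Ring.descPochhammer_smeval_add k (Commute.all r s)
  simp only [descPochhammer_smeval_eq_eval] at this
  rw [this, Finset.Nat.sum_antidiagonal_eq_sum_range_succ
    (fun i j => (k.choose i : ℝ) * ((ascPochhammer ℝ i).eval (r - i + 1) *
      (ascPochhammer ℝ j).eval (s - j + 1)))]

/-- The coefficient `(α+i+1)_{ℓ-i} (β+ℓ-i+1)_i / ((ℓ-i)! i!)` of the homogeneous Jacobi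
polynomial. -/
noncomputable def jacobiCoeff (ℓ : ℕ) (α β : ℝ) (i : ℕ) : ℝ :=
  (ascPochhammer ℝ (ℓ - i)).eval (α + i + 1) * (ascPochhammer ℝ i).eval (β + (ℓ - i : ℕ) + 1) /
    (((ℓ - i).factorial : ℝ) * (i.factorial : ℝ))

theorem ascPochhammer_eval_add_natCast (r : ℝ) (m n : ℕ) :
    (ascPochhammer ℝ (m + n)).eval r =
      (ascPochhammer ℝ m).eval r * (ascPochhammer ℝ n).eval (r + m) := by
  rw [← ascPochhammer_mul]
  simp

/-- Chu–Vandermonde splits `(α+β+ℓ+1)_j` with `r = β + ℓ`, `s = α + j`. In the `i`-th term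
`(α+i+1)_{j-i}` joins `(α+j+1)_{ℓ-j}` to form `(α+i+1)_{ℓ-i}`. -/
theorem jacobiCoeff_sum (ℓ : ℕ) (α β : ℝ) {j : ℕ} (hj : j ≤ ℓ) :
    ∑ i ∈ Finset.range (j + 1), jacobiCoeff ℓ α β i * ((ℓ - i).choose (j - i) : ℝ) =
      (ascPochhammer ℝ j).eval (α + β + ℓ + 1) * (ascPochhammer ℝ (ℓ - j)).eval (α + j + 1) /
      (((ℓ - j).factorial : ℝ) * (j.factorial : ℝ)) := by
  have hV := ascPochhammer_eval_add (β + ℓ) (α + j) j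
  rw [show α + β + ℓ + 1 = β + ℓ + (α + j) - j + 1 by ring, hV, Finset.sum_mul, Finset.sum_div]
  refine Finset.sum_congr rfl fun i hi => ?_
  have hij : i ≤ j := Nat.lt_succ_iff.1 (Finset.mem_range.1 hi)
  have hiℓ := hij.trans hj
  obtain ⟨a, rfl⟩ := Nat.exists_eq_add_of_le hij
  obtain ⟨b, rfl⟩ := Nat.exists_eq_add_of_le hj
  have s1 : i + a + b - i = a + b := by omega
  have s2 : i + a - i = a := by omega
  have s3 : i + a + b - (i + a) = b := by omega
  rw [jacobiCoeff, s1, s2, s3, ascPochhammer_eval_add_natCast, Nat.cast_choose ℝ (Nat.le_add_right a b),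
    Nat.cast_choose ℝ (Nat.le_add_right i a), Nat.add_sub_cancel_left, Nat.add_sub_cancel_left]
  push_cast
  rw [show β + ((i : ℝ) + a + b) - i + 1 = β + (a + b) + 1 by ring,
    show α + ((i : ℝ) + a) - a + 1 = α + i + 1 by ring,
    show α + (i : ℝ) + 1 + a = α + (i + a) + 1 by ring]
  have f1 : ((a + b).factorial : ℝ) ≠ 0 := by positivity
  have f2 : (a.factorial : ℝ) ≠ 0 := by positivity
  have f3 : (b.factorial : ℝ) ≠ 0 := by positivity
  have f4 : (i.factorial : ℝ) ≠ 0 := by positivity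
  have f5 : ((i + a).factorial : ℝ) ≠ 0 := by positivity
  field_simp

/-- Here `(t - 1)/2 = -x/(x + y)`. Expanding the powers of `y = (x + y) + (-x)` on the right, the
coefficients of `(-x)^j (x + y)^(ℓ-j)` match by `jacobiCoeff_sum`. -/
theorem jacobiP_homogeneous (ℓ : ℕ) (α β : ℝ) {x y : ℝ} (hs : x + y ≠ 0) :
    (x + y) ^ ℓ * jacobiP ℓ α β ((y - x) / (x + y)) =
      ∑ i ∈ Finset.range (ℓ + 1), jacobiCoeff ℓ α β i * ((-x) ^ i * y ^ (ℓ - i)) := by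
  have ht : ((y - x) / (x + y) - 1) / 2 = -x / (x + y) := by field_simp; ring
  have hpow : ∀ i ∈ Finset.range (ℓ + 1), jacobiCoeff ℓ α β i * ((-x) ^ i * y ^ (ℓ - i)) =
      ∑ j ∈ Finset.range (ℓ + 1), if i ≤ j then
        jacobiCoeff ℓ α β i * ((ℓ - i).choose (j - i) : ℝ) * ((-x) ^ j * (x + y) ^ (ℓ - j)) else 0 := by
    intro i hi
    have hi : i ≤ ℓ := Nat.lt_succ_iff.1 (Finset.mem_range.1 hi)
    have hy : y ^ (ℓ - i) = ∑ m ∈ Finset.range (ℓ - i + 1),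
        (-x) ^ m * (x + y) ^ (ℓ - i - m) * ((ℓ - i).choose m : ℝ) := by
      rw [← add_pow]; congr 1; ring
    rw [← Finset.sum_filter, hy, Finset.mul_sum, Finset.mul_sum]
    refine Finset.sum_bij' (fun m _ => i + m) (fun j _ => j - i) ?_ ?_ ?_ ?_ ?_
    · intro m hm; simp at hm ⊢; omega
    · intro j hj; simp at hj ⊢; omega
    · intro m hm; simp
    · intro j hj; simp at hj ⊢; omega
    · intro m hm
      rw [Nat.add_sub_cancel_left, pow_add, Nat.sub_sub]
      ring
  rw [Finset.sum_congr rfl hpow, Finset.sum_comm, jacobiP, Finset.mul_sum]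
  refine Finset.sum_congr rfl fun j hj => ?_
  have hj : j ≤ ℓ := Nat.lt_succ_iff.1 (Finset.mem_range.1 hj)
  rw [← Finset.sum_filter, ← Finset.sum_mul, ht]
  have : (Finset.range (ℓ + 1)).filter (fun i => i ≤ j) = Finset.range (j + 1) := by
    ext i; simp; omega
  rw [this, jacobiCoeff_sum ℓ α β hj, div_pow]
  have : (x + y) ^ ℓ = (x + y) ^ (ℓ - j) * (x + y) ^ j := by rw [← pow_add, Nat.sub_add_cancel hj]
  rw [this]
  field_simp

/-- The Gamma factors of the two one-variable integrals complete the rising factorials, so only a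
binomial coefficient depends on `i`. -/
theorem jacobiCoeff_mul_Gamma (ℓ : ℕ) {α β : ℝ} (hα : 0 < α) (hβ : 0 < β) {i : ℕ} (hi : i ≤ ℓ) :
    jacobiCoeff ℓ (α - 1) (β - 1) i * (Real.Gamma (α + i) * Real.Gamma (β + (ℓ - i : ℕ))) =
      Real.Gamma (α + ℓ) * Real.Gamma (β + ℓ) / ℓ.factorial * ℓ.choose i := by
  have hG : ∀ (r : ℝ) (_ : 0 < r) (n : ℕ),
      (ascPochhammer ℝ n).eval r * Real.Gamma r = Real.Gamma (r + n) := by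
    intro r hr n
    induction n with
    | zero => simp
    | succ n ih =>
      rw [ascPochhammer_succ_eval, mul_right_comm, ih, Nat.cast_succ, ← add_assoc,
        Real.Gamma_add_one (by positivity), mul_comm]
  have g1 := hG (α + i) (by positivity) (ℓ - i)
  have g2 := hG (β + (ℓ - i : ℕ)) (by positivity) i
  rw [add_assoc, ← Nat.cast_add, Nat.add_sub_cancel' hi] at g1
  rw [add_assoc, ← Nat.cast_add, Nat.sub_add_cancel hi] at g2
  rw [jacobiCoeff, Nat.cast_choose ℝ hi, ← g1, ← g2,
    show α - 1 + i + 1 = α + i by ring, show β - 1 + ((ℓ - i : ℕ) : ℝ) + 1 = β + (ℓ - i : ℕ) by ring]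
  have f1 : (ℓ.factorial : ℝ) ≠ 0 := by positivity
  field_simp

/-! ### Equivariance -/

theorem holographicFun_kernelFun {lam₁ lam₂ lam₃ : ℝ} {ℓ : ℕ}
    (hℓ : (ℓ : ℝ) = (lam₃ - lam₁ - lam₂) / 2) (w : ℍ) {p : ℝ × ℝ} (hx : 0 < p.1) (hy : 0 < p.2) :
    holographicFun lam₁ lam₂ ℓ (kernelFun lam₃ w) p =
      ∑ i ∈ Finset.range (ℓ + 1), (jacobiCoeff ℓ (lam₁ - 1) (lam₂ - 1) i * (-1) ^ i : ℂ) *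
        ((p.1 ^ i * kernelFun lam₁ w p.1) * (p.2 ^ (ℓ - i) * kernelFun lam₂ w p.2)) := by
  obtain ⟨x, y⟩ := p
  have hs : 0 < x + y := add_pos hx hy
  -- The power of `x + y` left over is exactly the one that homogenizes the Jacobi polynomial.
  have hpow : (x + y) ^ (-lam₁ - lam₂ - ℓ + 1) * (x + y) ^ (lam₃ - 1) = (x + y) ^ ℓ := by
    rw [← Real.rpow_add hs, ← Real.rpow_natCast]
    congr 1
    linarith
  have hJ := jacobiP_homogeneous ℓ (lam₁ - 1) (lam₂ - 1) hs.ne'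
  rw [← hpow] at hJ
  have hJ' := congrArg (fun r : ℝ => (r : ℂ)) hJ
  push_cast at hJ'
  have hexp : Complex.exp (-Complex.I * (starRingEnd ℂ) (w : ℂ) * ((x + y : ℝ) : ℂ)) =
      Complex.exp (-Complex.I * (starRingEnd ℂ) (w : ℂ) * x) *
        Complex.exp (-Complex.I * (starRingEnd ℂ) (w : ℂ) * y) := by
    rw [← Complex.exp_add]
    push_cast
    congr 1
    ring
  simp only [holographicFun, kernelFun]
  rw [hexp]
  push_cast
  calc _ = ((x ^ (lam₁ - 1) : ℝ) : ℂ) * ((y ^ (lam₂ - 1) : ℝ) : ℂ) *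
        Complex.exp (-Complex.I * (starRingEnd ℂ) (w : ℂ) * x) *
        Complex.exp (-Complex.I * (starRingEnd ℂ) (w : ℂ) * y) *
        (((x + y) ^ (-lam₁ - lam₂ - ℓ + 1) : ℝ) * ((x + y) ^ (lam₃ - 1) : ℝ) *
          jacobiP ℓ (lam₁ - 1) (lam₂ - 1) ((y - x) / (x + y))) := by ring
    _ = _ := by
      rw [hJ', Finset.mul_sum]
      refine Finset.sum_congr rfl fun i _ => ?_
      rw [neg_pow (x : ℂ) i]
      ring

/-- The pairing of `kernelVec z₁ ⊗ kernelVec z₂` with the image of `kernelVec w` under the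
holographic operator, up to a constant. -/
noncomputable def holographicKernel (lam₁ lam₂ : ℝ) (ℓ : ℕ) (z₁ z₂ w : ℍ) : ℂ :=
  Complex.exp (-lam₁ * Complex.log (polar z₁ w)) * Complex.exp (-lam₂ * Complex.log (polar z₂ w)) *
    (Complex.exp (-Complex.log (polar z₂ w)) - Complex.exp (-Complex.log (polar z₁ w))) ^ ℓ

theorem inner_tensor_kernelVec_holographicOp {lam₁ lam₂ lam₃ : ℝ} (h₁ : 1 < lam₁) (h₂ : 1 < lam₂)
    (h₃ : 1 < lam₃) {ℓ : ℕ} (hℓ : (ℓ : ℝ) = (lam₃ - lam₁ - lam₂) / 2)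
    {Φ : L2Half lam₃ →L[ℂ] L2Quadrant lam₁ lam₂}
    (hΦ : ∀ h : L2Half lam₃,
      Φ h =ᵐ[(weightMeasure lam₁).prod (weightMeasure lam₂)] holographicFun lam₁ lam₂ ℓ h)
    (z₁ z₂ w : ℍ) :
    ⟪tensor (kernelVec h₁ z₁) (kernelVec h₂ z₂), Φ (kernelVec h₃ w)⟫_ℂ =
      ((Real.Gamma (lam₁ + ℓ) * Real.Gamma (lam₂ + ℓ) / ℓ.factorial : ℝ) : ℂ) *
        holographicKernel lam₁ lam₂ ℓ z₁ z₂ w := by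
  set f : ℕ → ℝ → ℂ := fun i x =>
    (starRingEnd ℂ) (kernelFun lam₁ z₁ x) * (x ^ i * kernelFun lam₁ w x)
  set g : ℕ → ℝ → ℂ := fun i y =>
    (starRingEnd ℂ) (kernelFun lam₂ z₂ y) * (y ^ i * kernelFun lam₂ w y)
  have hae : ∀ᵐ p ∂((weightMeasure lam₁).prod (weightMeasure lam₂)),
      ⟪tensor (kernelVec h₁ z₁) (kernelVec h₂ z₂) p, Φ (kernelVec h₃ w) p⟫_ℂ =
        ∑ i ∈ Finset.range (ℓ + 1), (jacobiCoeff ℓ (lam₁ - 1) (lam₂ - 1) i * (-1) ^ i : ℂ) *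
          (f i p.1 * g (ℓ - i) p.2) := by
    filter_upwards [coeFn_tensor (kernelVec h₁ z₁) (kernelVec h₂ z₂),
      ae_prod_fst (coeFn_kernelVec h₁ z₁), ae_prod_snd (coeFn_kernelVec h₂ z₂),
      (hΦ (kernelVec h₃ w)).trans (holographicFun_congr_ae (coeFn_kernelVec h₃ w)),
      ae_prod_fst (ae_weightMeasure_pos lam₁), ae_prod_snd (ae_weightMeasure_pos lam₂)]
      with p e₁ e₂ e₃ e₄ hx hy
    rw [e₁, e₂, e₃, e₄, RCLike.inner_apply, holographicFun_kernelFun hℓ w hx hy, Finset.sum_mul]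
    refine Finset.sum_congr rfl fun i _ => ?_
    simp only [f, g, map_mul]
    ring
  rw [L2.inner_def, integral_congr_ae hae, integral_finsetSum _ fun i _ =>
    ((integrable_conj_kernelFun_mul h₁ z₁ w i).mul_prod
      (integrable_conj_kernelFun_mul h₂ z₂ w (ℓ - i))).const_mul _]
  -- The binomial expansion of the difference is matched with the Jacobi sum term by term.
  rw [holographicKernel, sub_eq_neg_add (Complex.exp _), add_pow, Finset.mul_sum, Finset.mul_sum]
  refine Finset.sum_congr rfl fun i hi => ?_
  have hi : i ≤ ℓ := Nat.lt_succ_iff.1 (Finset.mem_range.1 hi)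
  have hfg := integral_prod_mul (μ := weightMeasure lam₁) (ν := weightMeasure lam₂) (f i) (g (ℓ - i))
  simp only [f, g] at hfg
  rw [integral_const_mul, hfg, integral_conj_kernelFun_mul h₁, integral_conj_kernelFun_mul h₂]
  have hc := congrArg (fun r : ℝ => (r : ℂ))
    (jacobiCoeff_mul_Gamma ℓ (zero_lt_one.trans h₁) (zero_lt_one.trans h₂) hi)
  push_cast at hc ⊢
  have e : ∀ (lam : ℝ) (k : ℕ) (L : ℂ), Complex.exp (-(lam + k) * L) =
      Complex.exp (-lam * L) * Complex.exp (-L) ^ k := fun lam k L => by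
    rw [← Complex.exp_nat_mul, ← Complex.exp_add]
    congr 1
    ring
  rw [e, e, neg_pow (Complex.exp (-Complex.log (polar z₁ w)))]
  linear_combination ((-1) ^ i * Complex.exp (-lam₁ * Complex.log (polar z₁ w)) *
    Complex.exp (-Complex.log (polar z₁ w)) ^ i * Complex.exp (-lam₂ * Complex.log (polar z₂ w)) *
    Complex.exp (-Complex.log (polar z₂ w)) ^ (ℓ - i)) * hc

theorem exp_neg_log_polar_smul (g : SL2Cover) (z w : ℍ) :
    Complex.exp (-Complex.log (polar (g.toSL • z) (g.toSL • w))) =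
      autoFactor g.toSL z * (starRingEnd ℂ) (autoFactor g.toSL w) / polar z w := by
  rw [Complex.exp_neg, Complex.exp_log (polar_ne_zero _ _), ← polar_smul_mul g z w]
  have h1 := g.autoFactor_ne_zero z
  have h2 := (map_ne_zero (starRingEnd ℂ)).2 (g.autoFactor_ne_zero w)
  have h3 := polar_ne_zero (g.toSL • z) (g.toSL • w)
  field_simp

/-- Since `p₂⁻¹ - p₁⁻¹ = -i(z₁ - z₂)/(p₁ p₂)`, the automorphy factors at `z₁` and `z₂` cancel and
the one at `w` is squared. -/
theorem exp_neg_log_polar_smul_sub (g : SL2Cover) (z₁ z₂ w : ℍ) :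
    Complex.exp (-Complex.log (polar (g.toSL • z₂) (g.toSL • w))) -
        Complex.exp (-Complex.log (polar (g.toSL • z₁) (g.toSL • w))) =
      Complex.exp (2 * (starRingEnd ℂ) (g.logFactor w)) *
        (Complex.exp (-Complex.log (polar z₂ w)) - Complex.exp (-Complex.log (polar z₁ w))) := by
  have h1 := polar_ne_zero z₁ w
  have h2 := polar_ne_zero z₂ w
  rw [exp_neg_log_polar_smul, exp_neg_log_polar_smul, Complex.exp_neg, Complex.exp_neg,
    Complex.exp_log h1, Complex.exp_log h2, two_mul, Complex.exp_add, Complex.exp_conj,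
    g.exp_logFactor]
  field_simp
  simp only [polar, autoFactor, map_add, map_mul, Complex.conj_ofReal]
  ring

/-- The two powers contribute weight `lam₁ + lam₂` at `w` and the difference contributes `2ℓ`, which
is where the relation with `lam₃` is needed. -/
theorem holographicKernel_smul {lam₁ lam₂ lam₃ : ℝ} {ℓ : ℕ}
    (hℓ : (ℓ : ℝ) = (lam₃ - lam₁ - lam₂) / 2) (g : SL2Cover) (z₁ z₂ w : ℍ) :
    Complex.exp (-lam₁ * g.logFactor z₁) * Complex.exp (-lam₂ * g.logFactor z₂) *
        kernelMultiplier lam₃ g w *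
        holographicKernel lam₁ lam₂ ℓ (g.toSL • z₁) (g.toSL • z₂) (g.toSL • w) =
      holographicKernel lam₁ lam₂ ℓ z₁ z₂ w := by
  have h3 : (lam₃ : ℂ) = lam₁ + lam₂ + 2 * ℓ := by
    have : lam₃ = lam₁ + lam₂ + 2 * ℓ := by linarith
    exact_mod_cast this
  rw [holographicKernel, holographicKernel, exp_neg_log_polar_smul_sub, mul_pow, log_polar_smul,
    log_polar_smul, kernelMultiplier, h3, ← Complex.exp_nat_mul]
  simp only [← mul_assoc, ← Complex.exp_add]
  congr 2
  ring

theorem holographicOp_equivariant {lam₁ lam₂ lam₃ : ℝ} (h₁ : 1 < lam₁) (h₂ : 1 < lam₂)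
    (h₃ : 1 < lam₃) {ℓ : ℕ} (hℓ : (ℓ : ℝ) = (lam₃ - lam₁ - lam₂) / 2)
    {Φ : L2Half lam₃ →L[ℂ] L2Quadrant lam₁ lam₂}
    (hΦ : ∀ h : L2Half lam₃,
      Φ h =ᵐ[(weightMeasure lam₁).prod (weightMeasure lam₂)] holographicFun lam₁ lam₂ ℓ h)
    {ρ₁ : SL2Cover →* (L2Half lam₁ ≃ₗᵢ[ℂ] L2Half lam₁)}
    {ρ₂ : SL2Cover →* (L2Half lam₂ ≃ₗᵢ[ℂ] L2Half lam₂)}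
    {ρ₃ : SL2Cover →* (L2Half lam₃ ≃ₗᵢ[ℂ] L2Half lam₃)}
    {τ : SL2Cover →* (L2Quadrant lam₁ lam₂ ≃ₗᵢ[ℂ] L2Quadrant lam₁ lam₂)}
    (hρ₁ : IsL2Model lam₁ ρ₁) (hρ₂ : IsL2Model lam₂ ρ₂) (hρ₃ : IsL2Model lam₃ ρ₃)
    (hτ : IsTensorProductRep ρ₁ ρ₂ τ) (g : SL2Cover) (h : L2Half lam₃) :
    Φ (ρ₃ g h) = τ g (Φ h) := by
  -- With `τ g⁻¹` moved to the other slot, `g` acts on all three kernels at once and the covariance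
  -- of the kernel applies.
  have key : ∀ w, τ g⁻¹ (Φ (ρ₃ g (kernelVec h₃ w))) = Φ (kernelVec h₃ w) := fun w => by
    refine ((isTotal_kernelVec h₁).tensor (isTotal_kernelVec h₂)).ext fun p => ?_
    rw [← (τ g).inner_map_map, unitaryRep_apply_inv_apply, hτ, hρ₁.apply_kernelVec h₁,
      hρ₂.apply_kernelVec h₂, hρ₃.apply_kernelVec h₃, tensor_smul_left, tensor_smul_right,
      map_smul, inner_smul_left, inner_smul_left, inner_smul_right, conj_kernelMultiplier,
      conj_kernelMultiplier, inner_tensor_kernelVec_holographicOp h₁ h₂ h₃ hℓ hΦ,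
      inner_tensor_kernelVec_holographicOp h₁ h₂ h₃ hℓ hΦ, ← holographicKernel_smul hℓ g p.1 p.2 w]
    ring
  have heq := (isTotal_kernelVec h₃).eq_of_forall_apply_eq
    (S := Φ.comp ((ρ₃ g).toContinuousLinearEquiv : L2Half lam₃ →L[ℂ] L2Half lam₃))
    (T := ((τ g).toContinuousLinearEquiv :
      L2Quadrant lam₁ lam₂ →L[ℂ] L2Quadrant lam₁ lam₂).comp Φ) fun w => by
        change Φ (ρ₃ g (kernelVec h₃ w)) = τ g (Φ (kernelVec h₃ w))
        rw [← key, unitaryRep_apply_inv_apply]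
  exact congrArg (fun A : L2Half lam₃ →L[ℂ] L2Quadrant lam₁ lam₂ => A h) heq

end Holographic

theorem mainTheorem8 (lam₁ lam₂ lam₃ : ℝ) (h₁ : 1 < lam₁) (h₂ : 1 < lam₂) (h₃ : 1 < lam₃)
    (ℓ : ℕ) (hℓ : (ℓ : ℝ) = (lam₃ - lam₁ - lam₂) / 2) :
    -- the representations are well-defined
    (∃! ρ₁, IsL2Model lam₁ ρ₁) ∧ (∃! ρ₂, IsL2Model lam₂ ρ₂) ∧ (∃! ρ₃, IsL2Model lam₃ ρ₃) ∧
    (∀ (ρ₁ : SL2Cover →* (L2Half lam₁ ≃ₗᵢ[ℂ] L2Half lam₁))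
      (ρ₂ : SL2Cover →* (L2Half lam₂ ≃ₗᵢ[ℂ] L2Half lam₂)), ∃! τ, IsTensorProductRep ρ₁ ρ₂ τ) ∧
    -- the operator is continuous and equivariant
    ∃ Φ : L2Half lam₃ →L[ℂ] L2Quadrant lam₁ lam₂,
      (∀ h : L2Half lam₃,
        Φ h =ᵐ[(weightMeasure lam₁).prod (weightMeasure lam₂)] holographicFun lam₁ lam₂ ℓ h) ∧
      ∀ ρ₁ ρ₂ ρ₃ τ, IsL2Model lam₁ ρ₁ → IsL2Model lam₂ ρ₂ → IsL2Model lam₃ ρ₃ →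
        IsTensorProductRep ρ₁ ρ₂ τ → ∀ (g : SL2Cover) (h : L2Half lam₃), Φ (ρ₃ g h) = τ g (Φ h) := by
  obtain ⟨Φ, hΦ⟩ := exists_holographicOp h₁ h₂ hℓ
  exact ⟨existsUnique_isL2Model h₁, existsUnique_isL2Model h₂, existsUnique_isL2Model h₃,
    existsUnique_isTensorProductRep, Φ, hΦ, fun _ _ _ _ hρ₁ hρ₂ hρ₃ hτ =>
      holographicOp_equivariant h₁ h₂ h₃ hℓ hΦ hρ₁ hρ₂ hρ₃ hτ⟩
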